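/- Let $p$ be a prime number. For a commutative ring $A$ put $P(X,Y)=\sum_{i=1}^{p-1}\frac{(p-1)!}{i!\,(p-i)!}X^iY^{p-i}\in\mathbf Z[X,Y]$. A map $w\colon A\to M$ to an $A$-module is a Frobenius–Witt derivation (FW-derivation) if $w(a+b)=w(a)+w(b)-P(a,b)\,w(p)$ and $w(ab)=b^p w(a)+a^p w(b)$ for all $a,b\in A$. Let $w\colon A\to F\Omega^1_A$ be the universal FW-derivation: $F\Omega^1_A$ is the quotient of the free $A$-module on symbols $[a]$ ($a\in A$) by the submodule generated by the elements $[a+b]-[a]-[b]+P(a,b)[p]$ and $[ab]-a^p[b]-b^p[a]$, and $w(a)$ is the class of $[a]$. Write $A_1=A/pA$. If every integer prime to $p$ is invertible in $A$, then $p\cdot F\Omega^1_A=0$ and $F\Omega^1_A$ is an $A_1$-module. Let $A$ be a (noetherian) regular local ring with maximal ideal $\mathfrak m_A$ and residue field of characteristic $p$, let $I\subset\mathfrak m_A$ be an ideal, and put $B=A/I$, $B_1=B/pB$. For a $B_1$-module $M$ let $F^*M=M\otimes_{B_1,F}B_1$ be the scalar extension by the absolute Frobenius $F\colon B_1\to B_1$,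 $x\mapsto x^p$. Let $w\colon F^*(I\otimes_AB_1)\to F\Omega^1_A\otimes_AB_1$ be the $B_1$-linear map induced by the universal FW-derivation, $(x\otimes b)\otimes c\mapsto w(x)\otimes b^pc$, and let $F\Omega^1_A\otimes_AB_1\to F\Omega^1_B$ be the canonical $B_1$-linear map, sending $w(a)\otimes b$ to $b\cdot w(\bar a)$, where $\bar a$ is the class of $a$ in $B$. Consider the conditions: (1) The sequence of $B_1$-modules $$0\to F^*(I\otimes_AB_1)\xrightarrow{\;w\;}F\Omega^1_A\otimes_AB_1\to F\Omega^1_B\to 0$$ is a split exact sequence. (2) $B$ is regular. Then: 1. (1) implies (2). 2. If $F\Omega^1_A$ is a free $A_1$-module of finite rank, then (2) implies (1), and (2) also implies that $F\Omega^1_B$ is a free $B_1$-module of finite rank. -/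

import Mathlib

noncomputable section

namespace FrobeniusWitt

open scoped TensorProduct

universe u v

/-- The value `P(a, b)` of the integral polynomial
`P(X, Y) = ∑_{i=1}^{p-1} (p-1)! / (i! (p-i)!) X^i Y^{p-i}`.
For `p` prime and `0 < i < p` the division of natural numbers is exact. -/
def polyP (p : ℕ) {A : Type u} [CommRing A] (a b : A) : A :=
  ∑ i ∈ Finset.Ico 1 p, (((p - 1).factorial / (i.factorial * (p - i).factorial) : ℕ) : A) * a ^ i * b ^ (p - i)

theorem map_polyP (p : ℕ) {A : Type u} {B : Type v} [CommRing A] [CommRing B] (f : A →+* B)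
    (a b : A) : f (polyP p a b) = polyP p (f a) (f b) := by
  simp [polyP, map_sum]

theorem polyP_mul_right (p : ℕ) {A : Type u} [CommRing A] (x y a : A) :
    polyP p (x * a) (y * a) = a ^ p * polyP p x y := by
  unfold polyP
  rw [Finset.mul_sum]
  refine Finset.sum_congr rfl fun i hi => ?_
  have h : a ^ p = a ^ i * a ^ (p - i) := by
    rw [← pow_add, Nat.add_sub_cancel' (Finset.mem_Ico.1 hi).2.le]
  rw [h, mul_pow, mul_pow]
  ring

theorem polyP_mem (p : ℕ) {A : Type u} [CommRing A] (I : Ideal A) {x : A} (hx : x ∈ I) (y : A) :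
    polyP p x y ∈ I := by
  unfold polyP
  refine Ideal.sum_mem _ fun i hi => ?_
  refine Ideal.mul_mem_right _ _ (Ideal.mul_mem_left _ _ ?_)
  exact Ideal.pow_mem_of_mem _ hx _ (Finset.mem_Ico.1 hi).1

/-- A map `w : A → M` is a Frobenius-Witt derivation if
`w (a + b) = w a + w b - P(a, b) w p` and `w (a b) = b ^ p w a + a ^ p w b`. -/
structure IsFWDerivation (p : ℕ) {A : Type u} {M : Type v} [CommRing A] [AddCommGroup M]
    [Module A M] (w : A → M) : Prop where
  map_add : ∀ a b : A, w (a + b) = w a + w b - polyP p a b • w (p : A)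
  map_mul : ∀ a b : A, w (a * b) = b ^ p • w a + a ^ p • w b

/-- The relations `[a + b] - [a] - [b] + P(a, b) [p]` and `[a b] - a ^ p [b] - b ^ p [a]`
in the free `A`-module on the set `A`. -/
def relations (p : ℕ) (A : Type u) [CommRing A] : Submodule A (A →₀ A) :=
  Submodule.span A
    ({x | ∃ a b : A, x = Finsupp.single (a + b) 1 - Finsupp.single a 1 - Finsupp.single b 1 +
        polyP p a b • Finsupp.single (p : A) 1} ∪
      {x | ∃ a b : A, x = Finsupp.single (a * b) 1 - a ^ p • Finsupp.single b 1 -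
        b ^ p • Finsupp.single a 1})

/-- The module `FΩ¹_A` of Frobenius-Witt differentials of `A`. -/
def FOmega (p : ℕ) (A : Type u) [CommRing A] : Type u := (A →₀ A) ⧸ relations p A

instance (p : ℕ) (A : Type u) [CommRing A] : AddCommGroup (FOmega p A) :=
  inferInstanceAs (AddCommGroup ((A →₀ A) ⧸ relations p A))

instance (p : ℕ) (A : Type u) [CommRing A] : Module A (FOmega p A) :=
  inferInstanceAs (Module A ((A →₀ A) ⧸ relations p A))

/-- The canonical linear surjection from the free module on `A` to `FΩ¹_A`. -/
def FOmega.mk (p : ℕ) (A : Type u) [CommRing A] : (A →₀ A) →ₗ[A] FOmega p A :=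
  (relations p A).mkQ

/-- The universal Frobenius-Witt derivation `w : A → FΩ¹_A`. -/
def univ (p : ℕ) {A : Type u} [CommRing A] (a : A) : FOmega p A :=
  FOmega.mk p A (Finsupp.single a 1)

theorem univ_isFWDerivation (p : ℕ) (A : Type u) [CommRing A] :
    IsFWDerivation p (univ p : A → FOmega p A) where
  map_add a b := by
    have h : FOmega.mk p A (Finsupp.single (a + b) 1 - Finsupp.single a 1 - Finsupp.single b 1 +
        polyP p a b • Finsupp.single (p : A) 1) = 0 :=
      (Submodule.Quotient.mk_eq_zero _).2 (Submodule.subset_span (Or.inl ⟨a, b, rfl⟩))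
    rw [_root_.map_add, map_sub, map_sub, map_smul] at h
    rw [eq_sub_iff_add_eq, ← sub_eq_zero, ← h]
    simp only [univ]
    abel
  map_mul a b := by
    have h : FOmega.mk p A (Finsupp.single (a * b) 1 - a ^ p • Finsupp.single b 1 -
        b ^ p • Finsupp.single a 1) = 0 :=
      (Submodule.Quotient.mk_eq_zero _).2 (Submodule.subset_span (Or.inr ⟨a, b, rfl⟩))
    rw [map_sub, map_sub, map_smul, map_smul] at h
    rw [← sub_eq_zero, ← h]
    simp only [univ]
    abel

/-- The linear map `FΩ¹_A → M` corresponding to a Frobenius-Witt derivation `A → M`. -/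
def FOmega.lift {p : ℕ} {A : Type u} {M : Type v} [CommRing A] [AddCommGroup M] [Module A M]
    {w : A → M} (hw : IsFWDerivation p w) : FOmega p A →ₗ[A] M :=
  (relations p A).liftQ (Finsupp.linearCombination A w) (by
    refine Submodule.span_le.2 ?_
    rintro x (⟨a, b, rfl⟩ | ⟨a, b, rfl⟩)
    · simp only [SetLike.mem_coe, LinearMap.mem_ker, _root_.map_add, map_sub, map_smul,
        Finsupp.linearCombination_single, one_smul, hw.map_add]
      abel
    · simp [hw.map_mul])

@[simp]
theorem FOmega.lift_univ {p : ℕ} {A : Type u} {M : Type v} [CommRing A] [AddCommGroup M]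
    [Module A M] {w : A → M} (hw : IsFWDerivation p w) (a : A) :
    FOmega.lift hw (univ p a) = w a := by
  have : FOmega.lift hw (univ p a) = Finsupp.linearCombination A w (Finsupp.single a 1) := rfl
  simpa using this

theorem FOmega.induction_on {p : ℕ} {A : Type u} [CommRing A] {C : FOmega p A → Prop}
    (x : FOmega p A) (zero : C 0) (univ_mem : ∀ a, C (univ p a))
    (add : ∀ x y, C x → C y → C (x + y)) (smul : ∀ (a : A) (x), C x → C (a • x)) : C x := by
  obtain ⟨y, rfl⟩ := (relations p A).mkQ_surjective x
  change C (FOmega.mk p A y)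
  induction y using Finsupp.induction_linear with
  | zero => simpa using zero
  | add f g hf hg => rw [map_add]; exact add _ _ hf hg
  | single a b =>
    have : Finsupp.single a b = b • Finsupp.single a (1 : A) := by simp
    rw [this, map_smul]
    exact smul _ _ (univ_mem a)

theorem isFWDerivation_comp (p : ℕ) {A : Type u} {B : Type v} [CommRing A] [CommRing B]
    (f : A →+* B) : letI : Module A (FOmega p B) := Module.compHom _ f
    IsFWDerivation p (fun a : A => univ p (f a)) :=
  letI : Module A (FOmega p B) := Module.compHom _ f
  { map_add := fun a b => by
      have h := (univ_isFWDerivation p B).map_add (f a) (f b)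
      rw [← map_polyP, ← map_add, ← map_natCast f] at h
      exact h
    map_mul := fun a b => by
      have h := (univ_isFWDerivation p B).map_mul (f a) (f b)
      rw [← map_pow, ← map_pow, ← map_mul] at h
      exact h }

/-- The map `FΩ¹_A → FΩ¹_B`, `w a ↦ w (f a)`, induced by a ring homomorphism `f : A → B`. -/
def FOmega.map (p : ℕ) {A : Type u} {B : Type v} [CommRing A] [CommRing B] (f : A →+* B) :
    FOmega p A →ₛₗ[f] FOmega p B :=
  letI : Module A (FOmega p B) := Module.compHom _ f
  { toFun := FOmega.lift (isFWDerivation_comp p f)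
    map_add' := (FOmega.lift (isFWDerivation_comp p f)).map_add
    map_smul' := (FOmega.lift (isFWDerivation_comp p f)).map_smul }

@[simp]
theorem FOmega.map_univ (p : ℕ) {A : Type u} {B : Type v} [CommRing A] [CommRing B] (f : A →+* B)
    (a : A) : FOmega.map p f (univ p a) = univ p (f a) :=
  letI : Module A (FOmega p B) := Module.compHom _ f
  FOmega.lift_univ (isFWDerivation_comp p f) a

/-- `A` is a ring over `ℤ_(p)`: every natural number prime to `p` is invertible in `A`. -/
class IsOverZLocalized (p : ℕ) (A : Type u) [CommRing A] : Prop where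
  isUnit_natCast : ∀ n : ℕ, ¬ p ∣ n → IsUnit (n : A)

instance (p : ℕ) (A : Type u) [CommRing A] [IsLocalRing A]
    [CharP (IsLocalRing.ResidueField A) p] : IsOverZLocalized p A where
  isUnit_natCast n hn := by
    rw [← IsLocalRing.residue_ne_zero_iff_isUnit, map_natCast]
    exact fun h => hn ((CharP.cast_eq_zero_iff _ p n).1 h)

instance (p : ℕ) (A : Type u) [CommRing A] (I : Ideal A) [IsOverZLocalized p A] :
    IsOverZLocalized p (A ⧸ I) where
  isUnit_natCast n hn := by
    simpa using (IsOverZLocalized.isUnit_natCast (p := p) (A := A) n hn).map (Ideal.Quotient.mk I)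

section torsion

variable {p : ℕ} {A : Type u} {M : Type v} [CommRing A] [AddCommGroup M] [Module A M] {w : A → M}

theorem IsFWDerivation.map_one (hw : IsFWDerivation p w) : w 1 = 0 := by
  simpa using hw.map_mul 1 1

theorem IsFWDerivation.natCast_pow_smul (hp : p.Prime) (hw : IsFWDerivation p w) (a : A) (n : ℕ) :
    (n : A) ^ p • w a = (n : A) • w a := by
  induction n with
  | zero => simp [hp.ne_zero]
  | succ n ih =>
    have h1 := hw.map_mul ((n + 1 : ℕ) : A) a
    have h2 := hw.map_mul (n : A) a
    have h3 := hw.map_add (n : A) 1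
    have h4 := hw.map_add ((n : A) * a) (1 * a)
    rw [polyP_mul_right, ← add_mul, one_mul, h2] at h4
    rw [Nat.cast_add, Nat.cast_one, h4, h3, hw.map_one, mul_smul, smul_sub, smul_add, smul_zero,
      ih] at h1
    rw [Nat.cast_add, Nat.cast_one, add_smul, one_smul]
    have h5 := sub_eq_zero.2 h1
    rw [← sub_eq_zero, ← neg_eq_zero, ← h5]
    abel

theorem IsFWDerivation.smul_eq_zero (hp : p.Prime) [IsOverZLocalized p A]
    (hw : IsFWDerivation p w) (a : A) : (p : A) • w a = 0 := by
  have h := hw.natCast_pow_smul hp a p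
  have hdvd : ¬ p ∣ p ^ (p - 1) - 1 := by
    intro hd
    have h1 : p ∣ p ^ (p - 1) := dvd_pow_self p (by have := hp.two_le; omega)
    have h2 : 1 ≤ p ^ (p - 1) := Nat.one_le_pow _ _ hp.pos
    have h3 := (Nat.dvd_sub_iff_right h2 h1).1 hd
    exact hp.one_lt.ne' (Nat.dvd_one.1 h3)
  have hu := IsOverZLocalized.isUnit_natCast (p := p) (A := A) _ hdvd
  rw [← hu.smul_left_cancel, smul_zero, Nat.cast_sub (Nat.one_le_pow _ _ hp.pos), Nat.cast_pow,
    Nat.cast_one, sub_smul, one_smul, ← mul_smul, ← pow_succ, Nat.sub_add_cancel hp.one_le, h,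
    sub_self]

end torsion

/-- The quotient ring `A₁ = A / pA`. -/
abbrev RedMod (p : ℕ) (A : Type u) [CommRing A] : Type u := A ⧸ Ideal.span {(p : A)}

theorem FOmega.isTorsionBy (p : ℕ) [hp : Fact p.Prime] (A : Type u) [CommRing A]
    [IsOverZLocalized p A] : Module.IsTorsionBy A (FOmega p A) (p : A) := by
  intro x
  induction x using FOmega.induction_on with
  | zero => simp
  | univ_mem a => exact (univ_isFWDerivation p A).smul_eq_zero hp.out a
  | add x y hx hy => rw [smul_add, hx, hy, add_zero]
  | smul a x hx => rw [smul_comm, hx, smul_zero]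

/-- Over a ring `A` over `ℤ_(p)`, the `A`-module `FΩ¹_A` is killed by `p` and so is an
`A / pA`-module, with `(a mod p) • x = a • x`. -/
instance (p : ℕ) [Fact p.Prime] (A : Type u) [CommRing A] [IsOverZLocalized p A] :
    Module (RedMod p A) (FOmega p A) :=
  Module.IsTorsionBy.module (FOmega.isTorsionBy p A)

instance (p : ℕ) [Fact p.Prime] (A : Type u) [CommRing A] [IsOverZLocalized p A] :
    IsScalarTower A (RedMod p A) (FOmega p A) :=
  Module.IsTorsionBySet.isScalarTower _

/-- The absolute Frobenius `x ↦ x ^ p` of `A / pA`. -/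
def frob (p : ℕ) [hp : Fact p.Prime] (A : Type u) [CommRing A] : RedMod p A →+* RedMod p A where
  toFun x := x ^ p
  map_one' := one_pow p
  map_mul' x y := mul_pow x y p
  map_zero' := zero_pow hp.out.ne_zero
  map_add' x y := by
    obtain ⟨r, hr⟩ := exists_add_pow_prime_eq hp.out x y
    have h0 : (p : RedMod p A) = 0 := by
      rw [← map_natCast (Ideal.Quotient.mk (Ideal.span {(p : A)}))]
      exact Ideal.Quotient.eq_zero_iff_mem.2 (Ideal.mem_span_singleton_self _)
    rw [hr, h0]
    ring

/-- The ring `A / pA`, viewed as an algebra over `A / pA` through the absolute Frobenius. -/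
def FrobTarget (p : ℕ) (A : Type u) [CommRing A] : Type u := RedMod p A

instance (p : ℕ) (A : Type u) [CommRing A] : CommRing (FrobTarget p A) :=
  inferInstanceAs (CommRing (RedMod p A))

instance (p : ℕ) [Fact p.Prime] (A : Type u) [CommRing A] :
    Algebra (RedMod p A) (FrobTarget p A) :=
  (frob p A).toAlgebra

/-- The scalar extension `F^* M = M ⊗_{A₁, F} A₁` of an `A₁`-module `M` by the absolute Frobenius
`F` of `A₁ = A / pA`. The `A₁`-module structure is the one on the factor `A₁`. -/
def FrobPullback (p : ℕ) [Fact p.Prime] (A : Type u) [CommRing A] (M : Type v) [AddCommGroup M]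
    [Module (RedMod p A) M] : Type (max u v) :=
  FrobTarget p A ⊗[RedMod p A] M

section FrobPullback

variable (p : ℕ) [Fact p.Prime] (A : Type u) [CommRing A] (M : Type v) [AddCommGroup M]
  [Module (RedMod p A) M]

instance : AddCommGroup (FrobPullback p A M) :=
  inferInstanceAs (AddCommGroup (FrobTarget p A ⊗[RedMod p A] M))

instance : Module (RedMod p A) (FrobPullback p A M) :=
  inferInstanceAs (Module (FrobTarget p A) (FrobTarget p A ⊗[RedMod p A] M))

variable {A M}

/-- The element `m ⊗ c` of `F^* M`. -/
def FrobPullback.tmul (c : RedMod p A) (m : M) : FrobPullback p A M :=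
  (show FrobTarget p A from c) ⊗ₜ[RedMod p A] m

/-- The linear map `F^* M → N` induced by a Frobenius-semilinear map `M → N`. -/
def FrobPullback.lift {N : Type*} [AddCommGroup N] [Module (RedMod p A) N]
    (f : M →ₛₗ[frob p A] N) : FrobPullback p A M →ₗ[RedMod p A] N :=
  let g : FrobTarget p A ⊗[RedMod p A] M →+ N :=
    TensorProduct.liftAddHom
      (AddMonoidHom.mk'
        (fun c : FrobTarget p A => (AddMonoidHom.mk' (fun m : M => (show RedMod p A from c) • f m)
          (fun m m' => by rw [map_add, smul_add])))
        (fun c c' => by ext m; exact add_smul (show RedMod p A from c) c' (f m)))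
      (fun r c m => by
        change (frob p A r * (show RedMod p A from c)) • f m = (show RedMod p A from c) • f (r • m)
        rw [map_smulₛₗ, mul_comm, mul_smul])
  { toFun := g
    map_add' := g.map_add
    map_smul' := fun (c : FrobTarget p A) (x : FrobTarget p A ⊗[RedMod p A] M) => by
      change g (c • x) = (show RedMod p A from c) • g x
      induction x using TensorProduct.induction_on with
      | zero => rw [smul_zero, map_zero, smul_zero]
      | add x y hx hy => rw [smul_add, map_add, map_add, hx, hy, smul_add]
      | tmul d m =>
        rw [TensorProduct.smul_tmul']
        exact mul_smul (show RedMod p A from c) (show RedMod p A from d) (f m) }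

@[simp]
theorem FrobPullback.lift_tmul {N : Type*} [AddCommGroup N] [Module (RedMod p A) N]
    (f : M →ₛₗ[frob p A] N) (c : RedMod p A) (m : M) :
    FrobPullback.lift p f (FrobPullback.tmul p c m) = c • f m := rfl

end FrobPullback

/-- Elements of `I` kill `FΩ¹_A ⊗_A B₁`, where `B = A / I` and `B₁ = B / pB`. -/
theorem smul_tensor_eq_zero (p : ℕ) {A : Type u} [CommRing A] (I : Ideal A) {x : A} (hx : x ∈ I) (t : RedMod p (A ⧸ I) ⊗[A] FOmega p A) :
    x • t = 0 := by
  rw [← algebraMap_smul (RedMod p (A ⧸ I)) x t]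
  have : algebraMap A (RedMod p (A ⧸ I)) x = 0 := by
    rw [IsScalarTower.algebraMap_apply A (A ⧸ I) (RedMod p (A ⧸ I)),
      Ideal.Quotient.algebraMap_eq I, Ideal.Quotient.eq_zero_iff_mem.2 hx, map_zero]
  rw [this, zero_smul]

section sequence

variable (p : ℕ) [hp : Fact p.Prime] {A : Type u} [CommRing A] (I : Ideal A)

/-- The additive map `I → FΩ¹_A ⊗_A B₁`, `x ↦ w x ⊗ 1`. -/
def wAux : I →+ RedMod p (A ⧸ I) ⊗[A] FOmega p A :=
  AddMonoidHom.mk' (fun x => 1 ⊗ₜ[A] univ p (x : A)) (fun x y => by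
    have h := smul_tensor_eq_zero p I (polyP_mem p I x.2 (y : A)) (1 ⊗ₜ[A] univ p (p : A))
    rw [Submodule.coe_add, (univ_isFWDerivation p A).map_add, TensorProduct.tmul_sub,
      TensorProduct.tmul_add, TensorProduct.tmul_smul, h, sub_zero])

theorem wAux_smul (a : A) (x : I) : wAux p I (a • x) = a ^ p • wAux p I x := by
  change 1 ⊗ₜ[A] univ p (a * (x : A)) = a ^ p • 1 ⊗ₜ[A] univ p (x : A)
  have h := smul_tensor_eq_zero p I (Ideal.pow_mem_of_mem I x.2 p hp.out.pos)
    (1 ⊗ₜ[A] univ p a)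
  rw [(univ_isFWDerivation p A).map_mul, TensorProduct.tmul_add, TensorProduct.tmul_smul,
    TensorProduct.tmul_smul, h, zero_add]

/-- The Frobenius-semilinear map `I ⊗_A B₁ → FΩ¹_A ⊗_A B₁`, `x ⊗ b ↦ w x ⊗ b ^ p`. -/
def wSemilinear : RedMod p (A ⧸ I) ⊗[A] I →ₛₗ[frob p (A ⧸ I)]
    RedMod p (A ⧸ I) ⊗[A] FOmega p A :=
  let g : RedMod p (A ⧸ I) ⊗[A] I →+ RedMod p (A ⧸ I) ⊗[A] FOmega p A :=
    TensorProduct.liftAddHom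
      (AddMonoidHom.mk'
        (fun b => (AddMonoidHom.mk' (fun x : I => frob p (A ⧸ I) b • wAux p I x)
          (fun x y => by rw [map_add, smul_add])))
        (fun b b' => by
          ext x
          change frob p (A ⧸ I) (b + b') • wAux p I x = _
          rw [map_add, add_smul]; rfl))
      (fun a b x => by
        change frob p (A ⧸ I) (a • b) • wAux p I x = frob p (A ⧸ I) b • wAux p I (a • x)
        rw [wAux_smul, Algebra.smul_def, map_mul, mul_comm, mul_smul]
        change _ • (algebraMap A (RedMod p (A ⧸ I)) a ^ p) • _ = _
        rw [← map_pow, algebraMap_smul])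
  { toFun := g
    map_add' := g.map_add
    map_smul' := fun c x => by
      change g (c • x) = frob p (A ⧸ I) c • g x
      induction x using TensorProduct.induction_on with
      | zero => rw [smul_zero, map_zero, smul_zero]
      | add x y hx hy => rw [smul_add, map_add, map_add, hx, hy, smul_add]
      | tmul d x =>
        rw [TensorProduct.smul_tmul']
        change frob p (A ⧸ I) (c * d) • wAux p I x = _ • frob p (A ⧸ I) d • wAux p I x
        rw [map_mul, mul_smul] }

/-- The `B₁`-linear map `w : F^*(I ⊗_A B₁) → FΩ¹_A ⊗_A B₁` induced by the universal
Frobenius-Witt derivation, for `B = A / I` and `B₁ = B / pB`. -/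
def wMap : FrobPullback p (A ⧸ I) (RedMod p (A ⧸ I) ⊗[A] I) →ₗ[RedMod p (A ⧸ I)]
    RedMod p (A ⧸ I) ⊗[A] FOmega p A :=
  FrobPullback.lift p (wSemilinear p I)

theorem wMap_tmul (c b : RedMod p (A ⧸ I)) (x : I) :
    wMap p I (FrobPullback.tmul p c (b ⊗ₜ[A] x)) = (c * b ^ p) ⊗ₜ[A] univ p (x : A) := by
  have : wMap p I (FrobPullback.tmul p c (b ⊗ₜ[A] x)) =
      c • b ^ p • ((1 : RedMod p (A ⧸ I)) ⊗ₜ[A] univ p (x : A)) := rfl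
  rw [this, smul_smul, TensorProduct.smul_tmul', smul_eq_mul, mul_one]

variable [IsOverZLocalized p A]

/-- The canonical `B₁`-linear map `FΩ¹_A ⊗_A B₁ → FΩ¹_B`, `ω ⊗ b ↦ b • (image of ω)`, for
`B = A / I` and `B₁ = B / pB`. -/
def quotMap : RedMod p (A ⧸ I) ⊗[A] FOmega p A →ₗ[RedMod p (A ⧸ I)] FOmega p (A ⧸ I) :=
  let ψ := FOmega.map p (Ideal.Quotient.mk I)
  let g : RedMod p (A ⧸ I) ⊗[A] FOmega p A →+ FOmega p (A ⧸ I) :=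
    TensorProduct.liftAddHom
      (AddMonoidHom.mk'
        (fun b => (AddMonoidHom.mk' (fun x : FOmega p A => b • ψ x)
          (fun x y => by rw [map_add, smul_add])))
        (fun b b' => by ext x; exact add_smul b b' (ψ x)))
      (fun a b x => by
        change (a • b) • ψ x = b • ψ (a • x)
        have h : Ideal.Quotient.mk I a • ψ x = algebraMap A (RedMod p (A ⧸ I)) a • ψ x :=
          (algebraMap_smul (RedMod p (A ⧸ I)) (algebraMap A (A ⧸ I) a) (ψ x)).symm
        rw [map_smulₛₗ, h, smul_smul, Algebra.smul_def, mul_comm])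
  { toFun := g
    map_add' := g.map_add
    map_smul' := fun c x => by
      change g (c • x) = c • g x
      induction x using TensorProduct.induction_on with
      | zero => rw [smul_zero, map_zero, smul_zero]
      | add x y hx hy => rw [smul_add, map_add, map_add, hx, hy, smul_add]
      | tmul d x =>
        rw [TensorProduct.smul_tmul']
        exact mul_smul c d (ψ x) }

theorem quotMap_tmul (b : RedMod p (A ⧸ I)) (x : FOmega p A) :
    quotMap p I (b ⊗ₜ[A] x) = b • FOmega.map p (Ideal.Quotient.mk I) x := rfl

end sequence

/-- The sequence `0 → M' → M → M'' → 0` of `R`-modules is a split exact sequence. -/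
def IsSplitExact {R M' M M'' : Type*} [CommRing R] [AddCommGroup M'] [AddCommGroup M]
    [AddCommGroup M''] [Module R M'] [Module R M] [Module R M''] (f : M' →ₗ[R] M)
    (g : M →ₗ[R] M'') : Prop :=
  Function.Injective f ∧ Function.Exact f g ∧ Function.Surjective g ∧
    ∃ s : M'' →ₗ[R] M, g ∘ₗ s = LinearMap.id

end FrobeniusWitt

end

/-! Write `𝔪` and `k` for the maximal ideal and residue field of `A`. Right exactness of the
sequence is formal: `FΩ¹_B` is the quotient of `FΩ¹_A ⊗_A B₁` by the classes `w x` with `x ∈ I`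
(`exact_wMap_quotMap`). So everything turns on whether `wMap` has a linear retraction.

(1) ⇒ (2). Given a retraction and a linear form `f : I → k`, the map `f ^ p` is
Frobenius-semilinear, and composing it with the retraction gives an FW-derivation `D : A → k` with
`D x = f x ^ p` on `I`. Every such `D` kills `𝔪 ^ 2`, so every `f` kills `I ∩ 𝔪 ^ 2`; that is, `I ∩
𝔪 ^ 2 ⊆ 𝔪 I` (`inf_sq_le_mul_of_leftInverse`). Then `I` is generated by elements independent modulo
`𝔪 ^ 2`, and `A / I` is regular.

(2) ⇒ (1). Now `I` is generated by elements `x_i` independent modulo `𝔪 ^ 2`. The heart of the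
matter is that the `w x_i` stay independent over `k`, for which FW-derivations `A → k` dual to the
`x_i` are needed. `exists_isFWDerivation_eq` produces them: FW-derivations are sections of a ring of
pairs `FWExtension`, and dividing by the graph of a semilinear map `φ : 𝔪 → k` leaves a ring of
characteristic `p` that is an infinitesimal thickening of `k`. A coefficient field of it
(`exists_section_of_charP`) is the same as an FW-derivation extending `φ`. Nakayama's lemma then
turns independence over `k` into a retraction over the local ring `B₁`; splitting makes `FΩ¹_B`
projective, hence free. -/

noncomputable section

namespace FrobeniusWitt

open IsLocalRing
open scoped TensorProduct

/-! ### Regular local rings and their regular quotients. -/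

section regular

variable {A : Type*} [CommRing A]

/-- An independent family of classes of elements of `I` extends to a basis of the image of `I` in
the cotangent space. -/
theorem exists_linearIndepOn_toCotangent [IsLocalRing A] (I : Ideal A) {s : Set (maximalIdeal A)}
    (hsI : ∀ x ∈ s, (x : A) ∈ I)
    (hs : LinearIndepOn (ResidueField A) (maximalIdeal A).toCotangent s) :
    ∃ t : Set (maximalIdeal A), s ⊆ t ∧ (∀ x ∈ t, (x : A) ∈ I) ∧
      LinearIndepOn (ResidueField A) (maximalIdeal A).toCotangent t ∧
      ∀ x ∈ I, x ∈ maximalIdeal A →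
        ∃ y ∈ Ideal.span (Subtype.val '' t), x - y ∈ maximalIdeal A ^ 2 := by
  obtain ⟨t, htI, hst, hspan, ht⟩ := exists_linearIndepOn_extension
    (K := ResidueField A) (t := {x : maximalIdeal A | (x : A) ∈ I}) hs hsI
  refine ⟨t, hst, htI, ht, fun x hxI hxm => ?_⟩
  have h1 : (maximalIdeal A).toCotangent ⟨x, hxm⟩ ∈
      (Submodule.span (ResidueField A) ((maximalIdeal A).toCotangent '' t)).restrictScalars A :=
    hspan ⟨⟨x, hxm⟩, hxI, rfl⟩
  -- Since `A → k` is onto, the `k`-combination is an `A`-combination and lifts to the ideal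
  -- generated by `t`.
  rw [Submodule.restrictScalars_span A (ResidueField A) residue_surjective,
    ← Submodule.map_span] at h1
  obtain ⟨y, hy, hxy⟩ := h1
  refine ⟨y, ?_, (Ideal.toCotangent_eq _).1 hxy.symm⟩
  have h2 := Submodule.mem_map_of_mem (f := (maximalIdeal A).subtype) hy
  rwa [Submodule.map_span] at h2

theorem exists_ringKrullDim_eq_natCast (R : Type*) [CommRing R] [IsLocalRing R]
    [IsNoetherianRing R] : ∃ n : ℕ, ringKrullDim R = n := by
  have h1 : ringKrullDim R ≠ ⊥ := ringKrullDim_ne_bot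
  have h2 : ringKrullDim R ≠ ⊤ := ringKrullDim_ne_top
  generalize ringKrullDim R = d at h1 h2
  induction d with
  | bot => exact absurd rfl h1
  | coe d =>
    induction d with
    | top => exact absurd rfl h2
    | coe n => exact ⟨n, rfl⟩

theorem finite_of_linearIndepOn_toCotangent [IsLocalRing A] [IsNoetherianRing A]
    {s : Set (maximalIdeal A)}
    (hs : LinearIndepOn (ResidueField A) (maximalIdeal A).toCotangent s) : s.Finite :=
  Set.finite_coe_iff.1 (LinearIndependent.finite hs)

theorem ncard_le_of_linearIndepOn_toCotangent [IsLocalRing A] [IsNoetherianRing A]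
    {s : Set (maximalIdeal A)}
    (hs : LinearIndepOn (ResidueField A) (maximalIdeal A).toCotangent s) :
    s.ncard ≤ (maximalIdeal A).spanFinrank := by
  have := (finite_of_linearIndepOn_toCotangent hs).fintype
  rw [spanFinrank_maximalIdeal_eq_finrank_cotangentSpace, ← Nat.card_coe_set_eq,
    Nat.card_eq_fintype_card]
  exact LinearIndependent.fintype_card_le_finrank hs

/-- Nakayama's lemma for ideals of a noetherian local ring. -/
theorem le_of_le_sup_maximalIdeal_mul [IsLocalRing A] [IsNoetherianRing A] {I J : Ideal A}
    (h : I ≤ J ⊔ maximalIdeal A * I) : I ≤ J :=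
  Submodule.le_of_le_smul_of_le_jacobson_bot (IsNoetherian.noetherian I)
    (IsLocalRing.maximalIdeal_le_jacobson ⊥) h

/-- The quotient of a regular local ring by elements which are linearly independent modulo
`𝔪 ^ 2` is regular, of the expected dimension. -/
theorem isRegularLocalRing_quotient_span [IsRegularLocalRing A] {s : Set (maximalIdeal A)}
    (hs : LinearIndepOn (ResidueField A) (maximalIdeal A).toCotangent s) :
    IsRegularLocalRing (A ⧸ Ideal.span (Subtype.val '' s)) ∧
      ringKrullDim (A ⧸ Ideal.span (Subtype.val '' s)) + s.ncard = ringKrullDim A := by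
  set J := Ideal.span (Subtype.val '' s : Set A) with hJ
  have hJm : J ≤ maximalIdeal A := by
    rw [hJ, Ideal.span_le]
    rintro _ ⟨x, -, rfl⟩
    exact x.2
  have : Nontrivial (A ⧸ J) :=
    Ideal.Quotient.nontrivial_iff.2 fun h => (maximalIdeal.isMaximal A).ne_top (top_le_iff.1 (h ▸ hJm))
  have : IsLocalRing (A ⧸ J) := .of_surjective' (Ideal.Quotient.mk J) Ideal.Quotient.mk_surjective
  obtain ⟨t, hst, -, ht, hspan⟩ :=
    exists_linearIndepOn_toCotangent (maximalIdeal A) (fun x _ => x.2) hs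
  have htfin := finite_of_linearIndepOn_toCotangent ht
  have hm : maximalIdeal A ≤ Ideal.span (Subtype.val '' t) := by
    refine le_of_le_sup_maximalIdeal_mul fun x hx => ?_
    obtain ⟨y, hy, hxy⟩ := hspan x hx hx
    rw [← pow_two, ← add_sub_cancel y x]
    exact Submodule.add_mem_sup hy hxy
  have hmB : maximalIdeal (A ⧸ J) ≤
      Ideal.span (Ideal.Quotient.mk J '' (Subtype.val '' (t \ s))) := by
    intro b hb
    obtain ⟨a, rfl⟩ := Ideal.Quotient.mk_surjective b
    have ha : a ∈ maximalIdeal A := by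
      by_contra h
      exact hb ((notMem_maximalIdeal.1 h).map _)
    have h1 := Ideal.mem_map_of_mem (Ideal.Quotient.mk J) (hm ha)
    rw [Ideal.map_span] at h1
    refine Ideal.span_le.2 ?_ h1
    rintro _ ⟨_, ⟨x, hx, rfl⟩, rfl⟩
    by_cases hxs : x ∈ s
    · have : Ideal.Quotient.mk J x = 0 :=
        Ideal.Quotient.eq_zero_iff_mem.2 (Ideal.subset_span ⟨x, hxs, rfl⟩)
      rw [this]
      exact zero_mem _
    · exact Ideal.subset_span ⟨_, ⟨x, ⟨hx, hxs⟩, rfl⟩, rfl⟩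
  have hmB' : maximalIdeal (A ⧸ J) =
      Ideal.span (Ideal.Quotient.mk J '' (Subtype.val '' (t \ s))) := by
    refine le_antisymm hmB (Ideal.span_le.2 ?_)
    rintro _ ⟨_, ⟨x, -, rfl⟩, rfl⟩
    have : maximalIdeal A = (maximalIdeal (A ⧸ J)).comap (Ideal.Quotient.mk J) :=
      (eq_maximalIdeal (Ideal.comap_isMaximal_of_surjective _ Ideal.Quotient.mk_surjective)).symm
    exact this.le x.2
  -- The chain `dim A - |s| ≤ dim A/J ≤ edim A/J ≤ |t \ s| = |t| - |s| ≤ dim A - |s|` forces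
  -- equality throughout.
  have h1 : (maximalIdeal (A ⧸ J)).spanFinrank ≤ (t \ s).ncard := by
    rw [hmB']
    refine (Submodule.spanFinrank_span_le_ncard_of_finite
      (((htfin.sdiff).image _).image _)).trans ?_
    exact (Set.ncard_image_le ((htfin.sdiff).image _)).trans (Set.ncard_image_le htfin.sdiff)
  have h2 : (t \ s).ncard + s.ncard = t.ncard := Set.ncard_sdiff_add_ncard_of_subset hst htfin
  have h3 := ncard_le_of_linearIndepOn_toCotangent ht
  have h4 := ringKrullDim_le_spanFinrank_maximalIdeal (A ⧸ J)
  have h5 : ringKrullDim A ≤ ringKrullDim (A ⧸ J) + s.ncard := by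
    refine (ringKrullDim_le_ringKrullDim_quotient_add_encard (Subtype.val '' s : Set A) ?_).trans ?_
    · rintro _ ⟨x, -, rfl⟩
      exact (IsLocalRing.ringJacobson_eq_maximalIdeal A).ge x.2
    · gcongr
      have := Set.encard_image_le (Subtype.val : maximalIdeal A → A) s
      rw [← (finite_of_linearIndepOn_toCotangent hs).cast_ncard_eq] at this
      exact_mod_cast this
  have h6 := IsRegularLocalRing.spanFinrank_maximalIdeal (R := A)
  obtain ⟨n, hn⟩ := exists_ringKrullDim_eq_natCast (A ⧸ J)
  rw [← h6, hn] at h5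
  rw [hn] at h4
  norm_cast at h4 h5
  constructor
  · refine IsRegularLocalRing.of_spanFinrank_maximalIdeal_le _ ?_
    rw [hn]
    norm_cast
    omega
  · rw [hn, ← h6]
    norm_cast
    omega

/-- Induction on the embedding dimension. For `x ∈ 𝔪` outside `𝔪 ^ 2` and outside all minimal
primes, `A / (x)` is regular of smaller dimension, so `(x)` is prime. A minimal prime `q ⊆ (x)` does
not contain `x`, hence `q = x q`, and `q = 0` by Nakayama. -/
theorem isDomain_of_isRegularLocalRing (A : Type*) [CommRing A] [IsRegularLocalRing A] :
    IsDomain A := by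
  obtain ⟨n, hn⟩ : ∃ n, (maximalIdeal A).spanFinrank = n := ⟨_, rfl⟩
  induction n generalizing A with
  | zero =>
    rw [Submodule.spanFinrank_eq_zero_iff_eq_bot (IsNoetherian.noetherian _)] at hn
    exact (isField_iff_maximalIdeal_eq.2 hn).isDomain
  | succ n ih =>
    have hdim := IsRegularLocalRing.spanFinrank_maximalIdeal (R := A)
    obtain ⟨x, hxm, hx2, hxp⟩ : ∃ x ∈ maximalIdeal A, x ∉ maximalIdeal A ^ 2 ∧
        ∀ q ∈ minimalPrimes A, x ∉ q := by
      by_contra! hcon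
      have hfin : (minimalPrimes A).Finite := minimalPrimes.finite_of_isNoetherianRing A
      -- Prime avoidance tolerates two ideals that need not be prime; `𝔪 ^ 2` fills both slots.
      have h1 := (Ideal.subset_union_prime' (s := hfin.toFinset) (f := id)
        (a := maximalIdeal A ^ 2) (b := maximalIdeal A ^ 2) (I := maximalIdeal A)
        (fun q hq => (hfin.mem_toFinset.1 hq).1.1)).1 (fun x hx => by
          by_cases h2 : x ∈ maximalIdeal A ^ 2
          · exact Or.inl (Or.inl h2)
          · obtain ⟨q, hq, hxq⟩ := hcon x hx h2
            exact Or.inr (Set.mem_biUnion (hfin.mem_toFinset.2 hq) hxq))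
      have h2 : ¬ maximalIdeal A ≤ maximalIdeal A ^ 2 := by
        intro h
        have : maximalIdeal A ≤ ⊥ := le_of_le_sup_maximalIdeal_mul (by rwa [bot_sup_eq, ← pow_two])
        rw [le_bot_iff.1 this, Submodule.spanFinrank_bot] at hn
        omega
      obtain h | h | ⟨q, hq, h⟩ := h1
      · exact h2 h
      · exact h2 h
      · have hq' : q ∈ minimalPrimes A := hfin.mem_toFinset.1 hq
        have : maximalIdeal A = q := le_antisymm h (le_maximalIdeal hq'.1.1.ne_top)
        rw [← maximalIdeal_height_eq_ringKrullDim, hn, this] at hdim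
        have h0 : q.height = 0 := by
          have := hq'.1.1
          exact Ideal.height_eq_zero_iff.2 hq'
        rw [h0] at hdim
        norm_cast at hdim
    have hs : LinearIndepOn (ResidueField A) (maximalIdeal A).toCotangent
        ({⟨x, hxm⟩} : Set (maximalIdeal A)) := by
      have : IsDomain (ResidueField A) := Field.isDomain
      refine LinearIndepOn.singleton fun h => hx2 ?_
      exact ((maximalIdeal A).toCotangent_eq_zero ⟨x, hxm⟩).1 h
    obtain ⟨h1, h2⟩ := isRegularLocalRing_quotient_span hs
    rw [Set.image_singleton] at h1 h2
    have hprime : (Ideal.span {x}).IsPrime := by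
      rw [← Ideal.Quotient.isDomain_iff_prime]
      refine ih _ ?_
      rw [← IsRegularLocalRing.spanFinrank_maximalIdeal (R := A), hn,
        ← IsRegularLocalRing.spanFinrank_maximalIdeal, Set.ncard_singleton] at h2
      norm_cast at h2
      omega
    obtain ⟨q, hq, hqx⟩ := Ideal.exists_minimalPrimes_le (I := ⊥) (J := Ideal.span {x}) bot_le
    have hqp := hq.1.1
    have hq0 : q = ⊥ := by
      refine le_bot_iff.1 (le_of_le_sup_maximalIdeal_mul fun y hy => ?_)
      rw [bot_sup_eq]
      obtain ⟨z, rfl⟩ := Ideal.mem_span_singleton.1 (hqx hy)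
      exact Ideal.mul_mem_mul hxm ((hqp.mem_or_mem hy).resolve_left (hxp q hq))
    rw [hq0] at hqp
    exact IsDomain.of_bot_isPrime A

/-- An ideal of a regular local ring with regular quotient is generated by elements which are
linearly independent modulo `𝔪 ^ 2`. -/
theorem exists_span_eq_of_isRegularLocalRing_quotient [IsRegularLocalRing A] {I : Ideal A}
    (hI : I ≤ maximalIdeal A) (hB : IsRegularLocalRing (A ⧸ I)) :
    ∃ s : Set (maximalIdeal A),
      LinearIndepOn (ResidueField A) (maximalIdeal A).toCotangent s ∧
      I = Ideal.span (Subtype.val '' s) := by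
  obtain ⟨t, -, htI, ht, hspan⟩ := exists_linearIndepOn_toCotangent I
    (s := ∅) (by simp) (linearIndepOn_empty _ _)
  refine ⟨t, ht, ?_⟩
  have htfin := finite_of_linearIndepOn_toCotangent ht
  obtain ⟨hreg, hdim⟩ := isRegularLocalRing_quotient_span ht
  set J := Ideal.span (Subtype.val '' t : Set A) with hJ
  have hJI : J ≤ I := by
    rw [hJ, Ideal.span_le]
    rintro _ ⟨x, hx, rfl⟩
    exact htI x hx
  refine le_antisymm ?_ hJI
  obtain ⟨u, hucard, hu⟩ :=
    (IsNoetherian.noetherian (maximalIdeal (A ⧸ I))).exists_span_set_encard_eq_spanFinrank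
  have hufin : u.Finite := Set.finite_of_encard_eq_coe hucard
  obtain ⟨σ, hσ⟩ := (Ideal.Quotient.mk_surjective (I := I)).hasRightInverse
  have hm : maximalIdeal A ≤ Ideal.span (σ '' u ∪ Subtype.val '' t) := by
    refine le_of_le_sup_maximalIdeal_mul fun x hx => ?_
    have hx' : Ideal.Quotient.mk I x ∈ maximalIdeal (A ⧸ I) := by
      have : maximalIdeal A = (maximalIdeal (A ⧸ I)).comap (Ideal.Quotient.mk I) :=
        (eq_maximalIdeal (Ideal.comap_isMaximal_of_surjective _ Ideal.Quotient.mk_surjective)).symm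
      exact this.le hx
    have h1 : (Ideal.span (σ '' u)).map (Ideal.Quotient.mk I) = maximalIdeal (A ⧸ I) := by
      rw [Ideal.map_span, Set.image_image]
      simp only [hσ _, Set.image_id']
      exact hu
    rw [← h1, Ideal.mem_map_iff_of_surjective _ Ideal.Quotient.mk_surjective] at hx'
    obtain ⟨y, hy, hxy⟩ := hx'
    have hxyI : x - y ∈ I := Ideal.Quotient.eq.1 hxy.symm
    obtain ⟨z, hz, hxyz⟩ := hspan _ hxyI (hI hxyI)
    have : x = (y + z) + (x - y - z) := by ring
    rw [this, ← pow_two]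
    refine Submodule.add_mem_sup (add_mem ?_ ?_) hxyz
    · exact Ideal.span_mono Set.subset_union_left hy
    · exact Ideal.span_mono Set.subset_union_right hz
  have hm' : maximalIdeal A = Ideal.span (σ '' u ∪ Subtype.val '' t) := by
    refine le_antisymm hm (Ideal.span_le.2 (Set.union_subset ?_ ?_))
    · rintro _ ⟨b, hb, rfl⟩
      have : maximalIdeal A = (maximalIdeal (A ⧸ I)).comap (Ideal.Quotient.mk I) :=
        (eq_maximalIdeal (Ideal.comap_isMaximal_of_surjective _ Ideal.Quotient.mk_surjective)).symm
      rw [SetLike.mem_coe, this, Ideal.mem_comap]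
      rw [hσ, ← hu]
      exact Submodule.subset_span hb
    · rintro _ ⟨x, -, rfl⟩
      exact x.2
  -- By regularity of `A`, `A / I` and `A / J` this says `dim A/J ≤ dim A/I`.
  have h1 : (maximalIdeal A).spanFinrank ≤ (maximalIdeal (A ⧸ I)).spanFinrank + t.ncard := by
    have h2 : u.ncard = (maximalIdeal (A ⧸ I)).spanFinrank := by
      rw [Set.ncard, hucard, ENat.toNat_natCast]
    rw [← h2, show (maximalIdeal A).spanFinrank = _ from congrArg _ hm']
    refine (Submodule.spanFinrank_span_le_ncard_of_finite
      ((hufin.image _).union (htfin.image _))).trans ((Set.ncard_union_le _ _).trans ?_)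
    exact add_le_add (Set.ncard_image_le hufin) (Set.ncard_image_le htfin)
  -- An element of `I` outside `J` would be a nonzerodivisor of the domain `A / J`, and killing it
  -- would make the dimension drop strictly.
  intro z hz
  by_contra hzJ
  have := isDomain_of_isRegularLocalRing (A ⧸ J)
  have h2 : ringKrullDim (A ⧸ I) + 1 ≤ ringKrullDim (A ⧸ J) := by
    refine ringKrullDim_succ_le_of_surjective (Ideal.Quotient.factor hJI)
      (Ideal.Quotient.factor_surjective hJI) (r := Ideal.Quotient.mk J z) ?_ ?_
    · exact mem_nonZeroDivisors_of_ne_zero fun h => hzJ (Ideal.Quotient.eq_zero_iff_mem.1 h)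
    · rw [Ideal.Quotient.factor_mk]
      exact Ideal.Quotient.eq_zero_iff_mem.2 hz
  rw [← IsRegularLocalRing.spanFinrank_maximalIdeal (R := A ⧸ I),
    ← IsRegularLocalRing.spanFinrank_maximalIdeal (R := A ⧸ J)] at h2
  rw [← IsRegularLocalRing.spanFinrank_maximalIdeal (R := A),
    ← IsRegularLocalRing.spanFinrank_maximalIdeal (R := A ⧸ J)] at hdim
  norm_cast at h2 hdim
  omega

/-- Choose elements of `I` forming a basis of its image in `𝔪 / 𝔪 ^ 2`. They generate `I` up to `I ∩
𝔪 ^ 2 ⊆ 𝔪 I`, hence generate `I` by Nakayama. -/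
theorem isRegularLocalRing_quotient_of_inf_le_mul [IsRegularLocalRing A] {I : Ideal A}
    (hI : I ≤ maximalIdeal A) (h : I ⊓ maximalIdeal A ^ 2 ≤ maximalIdeal A * I) :
    IsRegularLocalRing (A ⧸ I) := by
  obtain ⟨t, -, htI, ht, hspan⟩ := exists_linearIndepOn_toCotangent I
    (s := ∅) (by simp) (linearIndepOn_empty _ _)
  have hle : Ideal.span (Subtype.val '' t) ≤ I := by
    rw [Ideal.span_le]
    rintro _ ⟨x, hx, rfl⟩
    exact htI x hx
  have : I = Ideal.span (Subtype.val '' t) := by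
    refine le_antisymm (le_of_le_sup_maximalIdeal_mul fun x hx => ?_) hle
    obtain ⟨y, hy, hxy⟩ := hspan x hx (hI hx)
    rw [← add_sub_cancel y x]
    exact Submodule.add_mem_sup hy (h ⟨sub_mem hx (hle hy), hxy⟩)
  rw [this]
  exact (isRegularLocalRing_quotient_span ht).1

end regular

/-! ### Identities for the polynomial `P`. -/

section polyP

/-- The division is exact: `i! (p - i)!` is prime to `p` and divides `p! = p (p - 1)!`. -/
theorem prime_mul_coeff_polyP {p : ℕ} (hp : p.Prime) {i : ℕ} (h0 : 0 < i) (hi : i < p) :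
    p * ((p - 1).factorial / (i.factorial * (p - i).factorial)) = p.choose i := by
  have h1 : p * (p - 1).factorial = p.factorial := Nat.mul_factorial_pred hp.ne_zero
  have hcop : (i.factorial * (p - i).factorial).Coprime p := by
    refine Nat.Coprime.mul_left ?_ ?_
    · exact ((hp.coprime_iff_not_dvd).2 fun h => by have := hp.dvd_factorial.1 h; omega).symm
    · exact ((hp.coprime_iff_not_dvd).2 fun h => by have := hp.dvd_factorial.1 h; omega).symm
  have hdvd : i.factorial * (p - i).factorial ∣ (p - 1).factorial := by
    refine hcop.dvd_of_dvd_mul_left ?_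
    rw [h1]
    exact Nat.factorial_mul_factorial_dvd_factorial hi.le
  rw [← Nat.mul_div_assoc _ hdvd, h1, Nat.choose_eq_factorial_div_factorial hi.le]

variable {p : ℕ} {A : Type*} [CommRing A]

theorem natCast_mul_polyP (hp : p.Prime) (a b : A) : (p : A) * polyP p a b = (a + b) ^ p - a ^ p - b ^ p := by
  have h : (a + b) ^ p = b ^ p + p * polyP p a b + a ^ p := by
    rw [add_pow, Finset.sum_range_succ, Finset.range_eq_Ico, Finset.sum_eq_sum_Ico_succ_bot hp.pos,
      polyP, Finset.mul_sum]
    congr 1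
    · congr 1
      · simp
      · refine Finset.sum_congr rfl fun i hi => ?_
        rw [Finset.mem_Ico] at hi
        rw [← prime_mul_coeff_polyP hp (by omega) hi.2]
        push_cast
        ring
    · simp
  rw [h]
  ring

/-- `A` may have `p`-torsion, so the identity is checked after multiplication by `p` in a polynomial
ring over `ℤ`, where `p` is cancellable, and then specialized. `polyP_cocycle` is obtained in the
same way. -/
theorem polyP_comm (hp : p.Prime) (a b : A) : polyP p a b = polyP p b a := by
  let X := (MvPolynomial.X : Fin 2 → MvPolynomial (Fin 2) ℤ)
  have h : polyP p (X 0) (X 1) = polyP p (X 1) (X 0) := by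
    refine mul_left_cancel₀ (Nat.cast_ne_zero.2 hp.ne_zero) ?_
    rw [natCast_mul_polyP hp, natCast_mul_polyP hp]
    ring
  simpa [X, map_polyP] using
    congrArg (MvPolynomial.eval₂Hom (Int.castRingHom A) ![a, b]) h

theorem polyP_cocycle (hp : p.Prime) (a b c : A) :
    polyP p a b + polyP p (a + b) c = polyP p b c + polyP p a (b + c) := by
  let X := (MvPolynomial.X : Fin 3 → MvPolynomial (Fin 3) ℤ)
  have h : polyP p (X 0) (X 1) + polyP p (X 0 + X 1) (X 2) =
      polyP p (X 1) (X 2) + polyP p (X 0) (X 1 + X 2) := by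
    refine mul_left_cancel₀ (Nat.cast_ne_zero.2 hp.ne_zero) ?_
    rw [mul_add, mul_add]
    simp only [natCast_mul_polyP hp]
    ring
  have h2 := congrArg (MvPolynomial.eval₂Hom (Int.castRingHom A) ![a, b, c]) h
  simp only [map_add, map_polyP] at h2
  simpa [X] using h2

theorem polyP_zero_right (a : A) : polyP p a 0 = 0 := by
  refine Finset.sum_eq_zero fun i hi => ?_
  rw [Finset.mem_Ico] at hi
  rw [zero_pow (by omega), mul_zero]

theorem polyP_zero_left (hp : p.Prime) (a : A) : polyP p 0 a = 0 := by
  rw [polyP_comm hp, polyP_zero_right]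

end polyP

/-! ### The ring of pairs whose sections are FW-derivations. -/

/-- The ring whose elements are pairs `(a, u)` with `a ∈ A` and `u ∈ K`, such that an additive and
multiplicative section `a ↦ (a, w a)` is a Frobenius-Witt derivation `w` with `w p = c`. -/
@[ext]
structure FWExtension (p : ℕ) (A K : Type*) [CommRing A] [CommRing K] [Algebra A K] (c : K) where
  /-- The first component. -/
  fst : A
  /-- The second component. -/
  snd : K

namespace FWExtension

variable {p : ℕ} {A K : Type*} [CommRing A] [CommRing K] [Algebra A K] {c : K}

instance : Add (FWExtension p A K c) :=
  ⟨fun x y => ⟨x.fst + y.fst, x.snd + y.snd - algebraMap A K (polyP p x.fst y.fst) * c⟩⟩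

instance : Mul (FWExtension p A K c) :=
  ⟨fun x y => ⟨x.fst * y.fst,
    algebraMap A K y.fst ^ p * x.snd + algebraMap A K x.fst ^ p * y.snd⟩⟩

instance : Zero (FWExtension p A K c) := ⟨⟨0, 0⟩⟩

instance : One (FWExtension p A K c) := ⟨⟨1, 0⟩⟩

instance : Neg (FWExtension p A K c) :=
  ⟨fun x => ⟨-x.fst, -x.snd + algebraMap A K (polyP p (-x.fst) x.fst) * c⟩⟩


@[simp] theorem fst_add (x y : FWExtension p A K c) : (x + y).fst = x.fst + y.fst := rfl

@[simp] theorem snd_add (x y : FWExtension p A K c) :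
    (x + y).snd = x.snd + y.snd - algebraMap A K (polyP p x.fst y.fst) * c := rfl

@[simp] theorem fst_mul (x y : FWExtension p A K c) : (x * y).fst = x.fst * y.fst := rfl

@[simp] theorem snd_mul (x y : FWExtension p A K c) :
    (x * y).snd = algebraMap A K y.fst ^ p * x.snd + algebraMap A K x.fst ^ p * y.snd := rfl

@[simp] theorem fst_zero : (0 : FWExtension p A K c).fst = 0 := rfl

@[simp] theorem snd_zero : (0 : FWExtension p A K c).snd = 0 := rfl

@[simp] theorem fst_one : (1 : FWExtension p A K c).fst = 1 := rfl

@[simp] theorem snd_one : (1 : FWExtension p A K c).snd = 0 := rfl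

@[simp] theorem fst_neg (x : FWExtension p A K c) : (-x).fst = -x.fst := rfl

@[simp] theorem snd_neg (x : FWExtension p A K c) :
    (-x).snd = -x.snd + algebraMap A K (polyP p (-x.fst) x.fst) * c := rfl

variable [hp : Fact p.Prime] [CharP K p]

/-- Associativity of addition is the cocycle identity for `P`. Distributivity combines the
homogeneity `polyP_mul_right` with additivity of the Frobenius of `K`, which is where characteristic
`p` enters. -/
instance : CommRing (FWExtension p A K c) where
  add_assoc x y z := by
    ext
    · simp [add_assoc]
    · have := congrArg (algebraMap A K) (polyP_cocycle hp.out x.fst y.fst z.fst)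
      simp only [map_add] at this
      simp only [fst_add, snd_add]
      linear_combination (-c) * this
  zero_add x := by ext <;> simp [polyP_zero_left hp.out]
  add_zero x := by ext <;> simp [polyP_zero_right]
  add_comm x y := by
    ext
    · simp [add_comm]
    · simp [polyP_comm hp.out x.fst, add_comm]
  neg_add_cancel x := by ext <;> simp
  nsmul := nsmulRec
  zsmul := zsmulRec
  mul_assoc x y z := by
    ext
    · simp [mul_assoc]
    · simp only [fst_mul, snd_mul, map_mul]; ring
  mul_comm x y := by
    ext
    · simp [mul_comm]
    · simp only [snd_mul]; ring
  one_mul x := by ext <;> simp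
  mul_one x := by ext <;> simp
  zero_mul x := by ext <;> simp [hp.out.ne_zero]
  mul_zero x := by ext <;> simp [hp.out.ne_zero]
  left_distrib x y z := by
    ext
    · simp [mul_add]
    · simp only [fst_mul, snd_mul, fst_add, snd_add, map_add, add_pow_char]
      rw [mul_comm x.fst y.fst, mul_comm x.fst z.fst, polyP_mul_right, map_mul, map_pow]
      ring
  right_distrib x y z := by
    ext
    · simp [add_mul]
    · simp only [fst_mul, snd_mul, fst_add, snd_add, map_add, add_pow_char]
      rw [polyP_mul_right, map_mul, map_pow]
      ring

@[simp]
theorem fst_natCast (n : ℕ) : (n : FWExtension p A K c).fst = n := by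
  induction n with
  | zero => simp
  | succ n ih => simp [ih]

/-- Each added `1` contributes `-P(n, 1) c`, and these sum to `(n - n ^ p) / p` times `c`. The
quotient is taken in `ℤ` because `p` vanishes in `K`. -/
theorem snd_natCast (n : ℕ) :
    ∃ d : ℤ, p * d = n - n ^ p ∧ (n : FWExtension p A K c).snd = d * c := by
  induction n with
  | zero => exact ⟨0, by simp [hp.out.ne_zero]⟩
  | succ n ih =>
    obtain ⟨d, hd, h⟩ := ih
    refine ⟨d - polyP p (n : ℤ) 1, ?_, ?_⟩
    · rw [mul_sub, natCast_mul_polyP hp.out, hd]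
      push_cast
      ring
    · have h1 : (polyP p (n : K) 1) = ((polyP p (n : ℤ) 1 : ℤ) : K) := by
        simpa using (map_polyP p (Int.castRingHom K) (n : ℤ) 1).symm
      rw [Nat.cast_succ, snd_add, h, fst_natCast, fst_one, snd_one, map_polyP, map_natCast,
        map_one, h1]
      push_cast
      ring

theorem natCast_prime : (p : FWExtension p A K c) = ⟨p, c⟩ := by
  ext
  · simp
  · obtain ⟨d, hd, h⟩ := snd_natCast (p := p) (A := A) (K := K) (c := c) p
    -- As `p - 1 > 0`, this is `1` modulo `p`; hence the parameter `c` is the second component of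
    -- `p`.
    have h1 : d = 1 - (p : ℤ) ^ (p - 1) := by
      refine mul_left_cancel₀ (Nat.cast_ne_zero.2 hp.out.ne_zero : (p : ℤ) ≠ 0) ?_
      rw [hd, mul_sub, mul_one, ← pow_succ', Nat.sub_add_cancel hp.out.one_le]
    rw [h, h1]
    push_cast
    rw [CharP.cast_eq_zero, zero_pow (by have := hp.out.two_le; omega), sub_zero, one_mul]

end FWExtension

/-! ### Coefficient fields in characteristic `p`. -/

section coefficientField

open Polynomial

/-- Adjoining to a subfield of `R` an element whose `p`-th power it contains gives a subring on which
the reduction is injective. -/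
theorem aeval_eq_zero_of_pow_mem {p : ℕ} [hp : Fact p.Prime] {S R k : Type*} [Field S] [CommRing R]
    [Field k] [CharP k p] [Algebra S R] (π : R →+* k) {x : R} {a : S}
    (hx : x ^ p = algebraMap S R a) (hS : ∀ b : S, π (algebraMap S R b) ≠ π x) (q : S[X])
    (hq : π (aeval x q) = 0) : aeval x q = 0 := by
  let : Algebra S k := (π.comp (algebraMap S R)).toAlgebra
  let π' : R →ₐ[S] k := { π with commutes' := fun _ => rfl }
  -- Reducibility would mean `a = b ^ p` with `b ∈ S`, and injectivity of Frobenius on `k` would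
  -- give `π b = π x`.
  have hirr : Irreducible (X ^ p - C a) := by
    refine X_pow_sub_C_irreducible_of_prime hp.out fun b hb => hS b ?_
    refine frobenius_inj k p ?_
    rw [frobenius_def, frobenius_def, ← map_pow, ← map_pow, ← map_pow, hb, hx]
  have hroot : aeval (π' x) (X ^ p - C a) = 0 := by
    have h : aeval x (X ^ p - C a) = 0 := by simp [hx]
    rw [aeval_algHom_apply, h, map_zero]
  have hmin := minpoly.eq_of_irreducible_of_monic hirr hroot (monic_X_pow_sub_C a hp.out.ne_zero)
  have hq' : aeval (π' x) q = 0 := by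
    rw [aeval_algHom_apply]
    exact hq
  obtain ⟨g, rfl⟩ := hmin ▸ minpoly.dvd S (π' x) hq'
  simp [hx]

/-- A ring `R` of characteristic `p` with a surjection to a field `k` whose kernel is killed by
`x ↦ x ^ p` contains a coefficient field. -/
theorem exists_section_of_charP {p : ℕ} [hp : Fact p.Prime] {R k : Type*} [CommRing R] [Field k]
    [CharP R p] [CharP k p] (π : R →+* k) (hπ : Function.Surjective π)
    (hker : ∀ x, π x = 0 → x ^ p = 0) : ∃ σ : k →+* R, ∀ x, π (σ x) = x := by
  -- Zorn's lemma is applied to subrings containing all `p`-th powers on which `π` is injective,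
  -- starting from the image of Frobenius. Keeping the `p`-th powers inside lets any new element be
  -- adjoined by an equation `X ^ p = a`.
  let 𝒮 : Set (Subring R) := {S | (∀ x, x ^ p ∈ S) ∧ ∀ s ∈ S, π s = 0 → s = 0}
  have h0 : (frobenius R p).range ∈ 𝒮 := by
    refine ⟨fun x => ⟨x, rfl⟩, ?_⟩
    rintro _ ⟨x, rfl⟩ h
    refine hker x ?_
    rw [frobenius_def, map_pow] at h
    exact pow_eq_zero_iff hp.out.ne_zero |>.1 h
  obtain ⟨S, -, hS⟩ := zorn_le_nonempty₀ 𝒮 (fun c hc hchain S₀ hS₀ => by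
    refine ⟨sSup c, ⟨fun x => ?_, fun s hs h => ?_⟩, fun S hS => le_sSup hS⟩
    · exact le_sSup hS₀ ((hc hS₀).1 x)
    · obtain ⟨S, hSc, hsS⟩ := (Subring.mem_sSup_of_directedOn ⟨S₀, hS₀⟩ hchain.directedOn).1 hs
      exact (hc hSc).2 s hsS h) _ h0
  obtain ⟨hpow, hinj⟩ := hS.prop
  have hfield : IsField S := by
    refine ⟨⟨0, 1, fun h => ?_⟩, mul_comm, fun {s} hs => ?_⟩
    · have := congrArg (fun s : S => π s) h
      simp at this
    · have hs' : π s ≠ 0 := fun h => hs (Subtype.ext (hinj s s.2 h))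
      obtain ⟨t, ht⟩ := hπ (π s)⁻¹
      -- The lift `t` of the inverse need not lie in `S`, but `t ^ p` does, and `s ^ (p - 1) t ^ p`
      -- has the right image.
      refine ⟨s ^ (p - 1) * ⟨t ^ p, hpow t⟩, Subtype.ext (sub_eq_zero.1 (hinj _ ?_ ?_))⟩
      · exact sub_mem (Subtype.prop _) (Subtype.prop _)
      · have h1 : π s ^ p * (π s)⁻¹ ^ p = 1 := by rw [← mul_pow, mul_inv_cancel₀ hs', one_pow]
        rw [← Nat.sub_add_cancel hp.out.one_le, pow_succ', Nat.sub_add_cancel hp.out.one_le] at h1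
        rw [inv_pow] at h1
        simp [ht, ← mul_assoc, h1]
  have hsurj : ∀ x, ∃ s : S, π s = π x := by
    intro x
    by_contra! hx
    let : Field S := hfield.toField
    have hT : (Algebra.adjoin S {x}).toSubring ∈ 𝒮 := by
      refine ⟨fun y => ?_, fun s hs h => ?_⟩
      · exact (Algebra.adjoin S {x}).algebraMap_mem ⟨y ^ p, hpow y⟩
      · rw [Subalgebra.mem_toSubring, Algebra.adjoin_singleton_eq_range_aeval] at hs
        obtain ⟨q, rfl⟩ := hs
        exact aeval_eq_zero_of_pow_mem (p := p) π (a := ⟨x ^ p, hpow x⟩) rfl hx q h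
    have hle : S ≤ (Algebra.adjoin S {x}).toSubring := fun s hs =>
      (Algebra.adjoin S {x}).algebraMap_mem ⟨s, hs⟩
    exact hx ⟨x, hS.le_of_ge hT hle (Algebra.self_mem_adjoin_singleton S x)⟩ rfl
  let e : S ≃+* k := RingEquiv.ofBijective (π.comp S.subtype)
    ⟨(injective_iff_map_eq_zero _).2 fun s hs => Subtype.ext (hinj s s.2 hs), fun y => by
      obtain ⟨x, rfl⟩ := hπ y
      exact hsurj x⟩
  exact ⟨S.subtype.comp (e.symm : k →+* S), fun x => e.apply_symm_apply x⟩

end coefficientField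

/-! ### Extending semilinear maps on `𝔪` to FW-derivations. -/

section extension

variable {p : ℕ} [hp : Fact p.Prime] {A : Type*} [CommRing A] [IsLocalRing A]
  [CharP (ResidueField A) p]

theorem natCast_mem_maximalIdeal (p : ℕ) (A : Type*) [CommRing A] [IsLocalRing A]
    [CharP (ResidueField A) p] : (p : A) ∈ maximalIdeal A := by
  rw [← residue_eq_zero_iff, map_natCast, CharP.cast_eq_zero]

theorem algebraMap_polyP_eq_zero {p : ℕ} (hp : p.Prime) {A : Type*} [CommRing A] [IsLocalRing A]
    (a : A) {y : A} (hy : y ∈ maximalIdeal A) :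
    algebraMap A (ResidueField A) (polyP p a y) = 0 := by
  rw [polyP_comm hp]
  exact (residue_eq_zero_iff _).2 (polyP_mem p _ hy a)

/-- The ideal of `FWExtension p A k c` formed by the graph of a Frobenius-semilinear map
`φ : 𝔪 → k`. -/
def graphIdeal (c : ResidueField A) (φ : maximalIdeal A →+ ResidueField A)
    (hφ : ∀ (a : A) (y : maximalIdeal A), φ (a • y) = residue A a ^ p * φ y) :
    Ideal (FWExtension p A (ResidueField A) c) where
  carrier := {x | ∃ y : maximalIdeal A, x = ⟨y, φ y⟩}
  zero_mem' := ⟨0, by ext <;> simp⟩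
  add_mem' := by
    rintro _ _ ⟨y, rfl⟩ ⟨z, rfl⟩
    refine ⟨y + z, FWExtension.ext (by simp) ?_⟩
    simp only [FWExtension.snd_add, algebraMap_polyP_eq_zero hp.out _ z.2, map_add, zero_mul,
      sub_zero]
  smul_mem' := by
    rintro x _ ⟨y, rfl⟩
    refine ⟨x.fst • y, ?_⟩
    ext
    · simp
    · simp [hφ, hp.out.ne_zero]

/-- Every Frobenius-semilinear map from the maximal ideal to the residue field extends to a
Frobenius-Witt derivation. -/
theorem exists_isFWDerivation_eq (φ : maximalIdeal A →+ ResidueField A)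
    (hφ : ∀ (a : A) (y : maximalIdeal A), φ (a • y) = residue A a ^ p * φ y) :
    ∃ D : A → ResidueField A, IsFWDerivation p D ∧ ∀ y : maximalIdeal A, D y = φ y := by
  -- This choice puts `p = (p, c)` on the graph of `φ`, so the quotient by the graph has
  -- characteristic `p`.
  let c := φ ⟨p, natCast_mem_maximalIdeal p A⟩
  let N := graphIdeal c φ hφ
  let q := Ideal.Quotient.mk N
  let f : FWExtension p A (ResidueField A) c →+* ResidueField A :=
    { toFun := fun x => residue A x.fst
      map_one' := by simp
      map_mul' := by simp
      map_zero' := by simp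
      map_add' := by simp }
  have hgraph : ∀ y : maximalIdeal A, q ⟨y, φ y⟩ = 0 := fun y =>
    Ideal.Quotient.eq_zero_iff_mem.2 ⟨y, rfl⟩
  have hadd : ∀ (a : A) (u : ResidueField A) (y : maximalIdeal A),
      (⟨a + y, u + φ y⟩ : FWExtension p A (ResidueField A) c) = ⟨a, u⟩ + ⟨y, φ y⟩ := fun a u y => by
    refine FWExtension.ext (by simp) ?_
    simp only [FWExtension.snd_add, algebraMap_polyP_eq_zero hp.out _ y.2, zero_mul, sub_zero]
  have hq : ∀ (a : A) (u : ResidueField A) (y : maximalIdeal A), q ⟨a + y, u + φ y⟩ = q ⟨a, u⟩ :=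
    fun a u y => by rw [hadd, map_add, hgraph, add_zero]
  let π := Ideal.Quotient.lift N f (by
    rintro _ ⟨y, rfl⟩
    exact (residue_eq_zero_iff _).2 y.2)
  have hπq : ∀ x, π (q x) = residue A x.fst := fun x => rfl
  have hπ : Function.Surjective π := fun b => by
    obtain ⟨a, rfl⟩ := residue_surjective b
    exact ⟨q ⟨a, 0⟩, rfl⟩
  have : Nontrivial (FWExtension p A (ResidueField A) c ⧸ N) := π.domain_nontrivial
  have : CharP (FWExtension p A (ResidueField A) c ⧸ N) p := by
    rw [CharP.charP_iff_prime_eq_zero hp.out, ← map_natCast q, FWExtension.natCast_prime]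
    exact hgraph ⟨p, natCast_mem_maximalIdeal p A⟩
  have hker : ∀ x, π x = 0 → x ^ p = 0 := by
    intro x hx
    obtain ⟨⟨a, u⟩, rfl⟩ := Ideal.Quotient.mk_surjective x
    have ha : a ∈ maximalIdeal A := (residue_eq_zero_iff _).1 hx
    -- Modulo the graph, an element of the kernel is represented by some `(0, v)`, whose square is
    -- zero.
    have h := hq 0 (u - φ ⟨a, ha⟩) ⟨a, ha⟩
    rw [zero_add, sub_add_cancel] at h
    change q ⟨a, u⟩ ^ p = 0
    have h2 : (⟨0, u - φ ⟨a, ha⟩⟩ : FWExtension p A (ResidueField A) c) ^ 2 = 0 := by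
      rw [pow_two]
      ext <;> simp [hp.out.ne_zero]
    rw [h, ← map_pow, pow_eq_zero_of_le hp.out.two_le h2, map_zero]
  obtain ⟨σ, hσ⟩ := exists_section_of_charP (p := p) π hπ hker
  -- The derivation is read off from the coefficient field: `D a` is the unique `u` for which `(a,
  -- u)` represents `σ` of the residue of `a`. For `a ∈ 𝔪` that class is zero, so `(a, D a)` lies on
  -- the graph of `φ`.
  have hex : ∀ a, ∃ u, q ⟨a, u⟩ = σ (residue A a) := by
    intro a
    obtain ⟨⟨b, v⟩, hb⟩ := Ideal.Quotient.mk_surjective (σ (residue A a))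
    have hba : b - a ∈ maximalIdeal A := by
      rw [← residue_eq_zero_iff, map_sub, ← hσ (residue A a), ← hb]
      exact sub_self _
    refine ⟨v - φ ⟨b - a, hba⟩, ?_⟩
    have h := hq a (v - φ ⟨b - a, hba⟩) ⟨b - a, hba⟩
    rw [add_sub_cancel, sub_add_cancel] at h
    exact h.symm.trans hb
  have huniq : ∀ a u v, q ⟨a, u⟩ = q ⟨a, v⟩ → u = v := by
    intro a u v h
    have h1 : (⟨a, u⟩ : FWExtension p A (ResidueField A) c) = ⟨a, v⟩ + ⟨0, u - v⟩ := by
      ext <;> simp [polyP_zero_right]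
    rw [h1, map_add, add_eq_left] at h
    obtain ⟨y, hy⟩ := Ideal.Quotient.eq_zero_iff_mem.1 h
    rw [FWExtension.mk.injEq] at hy
    have : y = 0 := Subtype.ext hy.1.symm
    rw [this, map_zero] at hy
    exact sub_eq_zero.1 hy.2
  choose D hD using hex
  have hDφ : ∀ y : maximalIdeal A, D y = φ y := fun y => by
    refine huniq y _ _ ?_
    rw [hD, hgraph, (residue_eq_zero_iff _).2 y.2, map_zero]
  refine ⟨D, ⟨fun a b => huniq (a + b) _ _ ?_, fun a b => huniq (a * b) _ _ ?_⟩, hDφ⟩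
  · rw [hD, map_add, map_add, ← hD a, ← hD b, ← map_add]
    congr 1
    ext
    · simp
    · rw [hDφ ⟨p, natCast_mem_maximalIdeal p A⟩]
      simp [Algebra.smul_def, c]
  · rw [hD, map_mul, map_mul, ← hD a, ← hD b, ← map_mul]
    congr 1

end extension

/-! ### Right exactness of the sequence. -/

section exactness

theorem tmul_univ_congr (p : ℕ) {A : Type*} [CommRing A] (I : Ideal A) {a a' : A}
    (h : a' - a ∈ I) :
    (1 : RedMod p (A ⧸ I)) ⊗ₜ[A] univ p a' = 1 ⊗ₜ[A] univ p a + 1 ⊗ₜ[A] univ p (a' - a) := by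
  have h1 := (univ_isFWDerivation p A).map_add (a' - a) a
  have h2 := smul_tensor_eq_zero p I (polyP_mem p I h a) (1 ⊗ₜ[A] univ p (p : A))
  rw [sub_add_cancel] at h1
  rw [h1, TensorProduct.tmul_sub, TensorProduct.tmul_smul, h2, sub_zero, TensorProduct.tmul_add,
    add_comm]

variable (p : ℕ) [hp : Fact p.Prime] {A : Type*} [CommRing A] (I : Ideal A)

/-- `F^*(I ⊗_A B₁)` is generated by the classes of generators of `I`. -/
theorem span_frobPullback_eq_top {ι : Type*} {x : ι → I} (hx : Submodule.span A (Set.range x) = ⊤) :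
    Submodule.span (RedMod p (A ⧸ I)) (Set.range fun i =>
      (FrobPullback.tmul p 1 (1 ⊗ₜ[A] x i) :
        FrobPullback p (A ⧸ I) (RedMod p (A ⧸ I) ⊗[A] I))) = ⊤ := by
  set T := Submodule.span (RedMod p (A ⧸ I)) (Set.range fun i =>
      (FrobPullback.tmul p 1 (1 ⊗ₜ[A] x i) :
        FrobPullback p (A ⧸ I) (RedMod p (A ⧸ I) ⊗[A] I))) with hT
  have hsmul : ∀ (b : RedMod p (A ⧸ I)) (m : RedMod p (A ⧸ I) ⊗[A] I),
      FrobPullback.tmul p 1 (b • m) = b ^ p • FrobPullback.tmul p 1 m := fun b m => by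
    change (1 : FrobTarget p (A ⧸ I)) ⊗ₜ[RedMod p (A ⧸ I)] (b • m) =
      (show FrobTarget p (A ⧸ I) from b ^ p) • ((1 : FrobTarget p (A ⧸ I)) ⊗ₜ[RedMod p (A ⧸ I)] m)
    rw [← TensorProduct.smul_tmul, TensorProduct.smul_tmul']
    rfl
  have hadd : ∀ m m' : RedMod p (A ⧸ I) ⊗[A] I,
      FrobPullback.tmul p (A := A ⧸ I) 1 (m + m') = FrobPullback.tmul p 1 m + FrobPullback.tmul p 1 m' :=
    fun m m' => TensorProduct.tmul_add _ _ _
  have hzero : FrobPullback.tmul p (A := A ⧸ I) 1 (0 : RedMod p (A ⧸ I) ⊗[A] I) = 0 :=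
    TensorProduct.tmul_zero _ _
  have h1 : ∀ y : I, FrobPullback.tmul p 1 ((1 : RedMod p (A ⧸ I)) ⊗ₜ[A] y) ∈ T := by
    intro y
    have hy : y ∈ Submodule.span A (Set.range x) := hx ▸ Submodule.mem_top
    induction hy using Submodule.span_induction with
    | mem y hy =>
      obtain ⟨i, rfl⟩ := hy
      exact Submodule.subset_span ⟨i, rfl⟩
    | zero =>
      rw [TensorProduct.tmul_zero, hzero]
      exact zero_mem _
    | add y z _ _ hy hz =>
      rw [TensorProduct.tmul_add, hadd]
      exact add_mem hy hz
    | smul a y _ hy =>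
      rw [TensorProduct.tmul_smul, ← algebraMap_smul (RedMod p (A ⧸ I)) a, hsmul]
      exact T.smul_mem _ hy
  have h2 : ∀ m : RedMod p (A ⧸ I) ⊗[A] I, FrobPullback.tmul p 1 m ∈ T := by
    intro m
    induction m using TensorProduct.induction_on with
    | zero =>
      rw [hzero]
      exact zero_mem _
    | add y z hy hz =>
      rw [hadd]
      exact add_mem hy hz
    | tmul b y =>
      have : b ⊗ₜ[A] y = b • ((1 : RedMod p (A ⧸ I)) ⊗ₜ[A] y) := by
        rw [TensorProduct.smul_tmul', smul_eq_mul, mul_one]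
      rw [this, hsmul]
      exact T.smul_mem _ (h1 y)
  refine top_le_iff.1 fun z _ => ?_
  change FrobTarget p (A ⧸ I) ⊗[RedMod p (A ⧸ I)] (RedMod p (A ⧸ I) ⊗[A] I) at z
  induction z using TensorProduct.induction_on with
  | zero => exact T.zero_mem
  | add y z hy hz => exact T.add_mem (hy trivial) (hz trivial)
  | tmul c m =>
    have h3 := T.smul_mem (show RedMod p (A ⧸ I) from c) (h2 m)
    have h4 : (show RedMod p (A ⧸ I) from c) • FrobPullback.tmul p 1 m =
        (c ⊗ₜ[RedMod p (A ⧸ I)] m : FrobTarget p (A ⧸ I) ⊗[RedMod p (A ⧸ I)] _) := by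
      change c • ((1 : FrobTarget p (A ⧸ I)) ⊗ₜ[RedMod p (A ⧸ I)] m) = _
      rw [TensorProduct.smul_tmul', smul_eq_mul, mul_one]
    exact (congrArg (· ∈ T) h4).mp h3

theorem univ_zero : univ p (0 : A) = 0 := by
  simpa [hp.out.ne_zero] using (univ_isFWDerivation p A).map_mul 0 0

variable [IsOverZLocalized p A]

theorem quotMap_comp_wMap : quotMap p I ∘ₗ wMap p I = 0 := by
  refine LinearMap.ext_on (span_frobPullback_eq_top p I (x := id) (by simp)) ?_
  rintro _ ⟨y, rfl⟩
  simp only [LinearMap.comp_apply, id_eq, wMap_tmul, quotMap_tmul, FOmega.map_univ,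
    Ideal.Quotient.eq_zero_iff_mem.2 y.2, univ_zero, smul_zero, LinearMap.zero_apply]

theorem quotMap_surjective : Function.Surjective (quotMap p I) := by
  rw [← LinearMap.range_eq_top]
  refine top_le_iff.1 fun z _ => ?_
  induction z using FOmega.induction_on with
  | zero => exact zero_mem _
  | add x y hx hy => exact add_mem (hx trivial) (hy trivial)
  | smul b x hx =>
    rw [← algebraMap_smul (RedMod p (A ⧸ I)) b x]
    exact Submodule.smul_mem _ _ (hx trivial)
  | univ_mem b =>
    obtain ⟨a, rfl⟩ := Ideal.Quotient.mk_surjective b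
    exact ⟨1 ⊗ₜ univ p a, by rw [quotMap_tmul, FOmega.map_univ, one_smul]⟩

/-- A linear map on `FΩ¹_A ⊗_A B₁` killing `w x` for `x ∈ I` factors through `FΩ¹_B`. -/
theorem exists_eq_comp_quotMap {C : Type*} [AddCommGroup C] [Module (RedMod p (A ⧸ I)) C]
    (ψ : RedMod p (A ⧸ I) ⊗[A] FOmega p A →ₗ[RedMod p (A ⧸ I)] C)
    (hψ : ∀ x ∈ I, ψ (1 ⊗ₜ univ p x) = 0) :
    ∃ g : FOmega p (A ⧸ I) →ₗ[RedMod p (A ⧸ I)] C, g ∘ₗ quotMap p I = ψ := by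
  let : Module (A ⧸ I) C := Module.compHom C (algebraMap (A ⧸ I) (RedMod p (A ⧸ I)))
  have hC : ∀ (b : A ⧸ I) (z : C), b • z = algebraMap (A ⧸ I) (RedMod p (A ⧸ I)) b • z :=
    fun _ _ => rfl
  obtain ⟨σ, hσ⟩ := (Ideal.Quotient.mk_surjective (I := I)).hasRightInverse
  -- Any set-theoretic section will do: changing a lift by `I` changes `1 ⊗ w` by an element `1 ⊗ w
  -- x` with `x ∈ I`, which `ψ` kills.
  let D : A ⧸ I → C := fun b => ψ (1 ⊗ₜ univ p (σ b))
  have hD : ∀ a, D (Ideal.Quotient.mk I a) = ψ (1 ⊗ₜ univ p a) := fun a => by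
    have h : σ (Ideal.Quotient.mk I a) - a ∈ I := Ideal.Quotient.eq.1 (hσ _)
    change ψ _ = _
    rw [tmul_univ_congr p I h, map_add, hψ _ h, add_zero]
  have hsmul : ∀ (a : A) (ω : FOmega p A),
      ψ (1 ⊗ₜ (a • ω)) = Ideal.Quotient.mk I a • ψ (1 ⊗ₜ ω) := fun a ω => by
    rw [TensorProduct.tmul_smul, ← algebraMap_smul (RedMod p (A ⧸ I)) a, map_smul]
    rfl
  have hFW : IsFWDerivation p D := by
    constructor
    · intro a b
      obtain ⟨a, rfl⟩ := Ideal.Quotient.mk_surjective a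
      obtain ⟨b, rfl⟩ := Ideal.Quotient.mk_surjective b
      rw [← map_add, ← map_natCast (Ideal.Quotient.mk I), ← map_polyP, hD, hD, hD, hD,
        (univ_isFWDerivation p A).map_add, TensorProduct.tmul_sub, TensorProduct.tmul_add, map_sub,
        map_add, hsmul]
    · intro a b
      obtain ⟨a, rfl⟩ := Ideal.Quotient.mk_surjective a
      obtain ⟨b, rfl⟩ := Ideal.Quotient.mk_surjective b
      rw [← map_mul, hD, hD, hD, (univ_isFWDerivation p A).map_mul, TensorProduct.tmul_add, map_add,
        hsmul, hsmul, map_pow, map_pow]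
  let g : FOmega p (A ⧸ I) →ₗ[RedMod p (A ⧸ I)] C :=
    { toFun := FOmega.lift hFW
      map_add' := map_add _
      map_smul' := fun b z => by
        obtain ⟨b, rfl⟩ := Ideal.Quotient.mk_surjective b
        exact (FOmega.lift hFW).map_smul b z }
  have hg : ∀ b, g (univ p b) = D b := fun b => FOmega.lift_univ hFW b
  refine ⟨g, ?_⟩
  have hω : ∀ ω, g (quotMap p I (1 ⊗ₜ ω)) = ψ (1 ⊗ₜ ω) := fun ω => by
    induction ω using FOmega.induction_on with
    | zero => simp
    | univ_mem a => rw [quotMap_tmul, one_smul, FOmega.map_univ, hg, hD]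
    | add x y hx hy => rw [TensorProduct.tmul_add, map_add, map_add, map_add, hx, hy]
    | smul a x hx =>
      rw [TensorProduct.tmul_smul, ← algebraMap_smul (RedMod p (A ⧸ I)) a, map_smul, map_smul,
        map_smul, hx]
  ext t
  induction t using TensorProduct.induction_on with
  | zero => rw [map_zero, map_zero]
  | add x y hx hy => rw [map_add, map_add, hx, hy]
  | tmul b ω =>
    rw [← mul_one b, ← smul_eq_mul, ← TensorProduct.smul_tmul', map_smul, map_smul,
      LinearMap.comp_apply, hω]

/-- The projection onto the cokernel of `wMap` kills each `w x` with `x ∈ I`, so it factors through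
`quotMap`; this bounds the kernel of `quotMap`. -/
theorem exact_wMap_quotMap : Function.Exact (wMap p I) (quotMap p I) := by
  intro t
  constructor
  · intro ht
    obtain ⟨g, hg⟩ := exists_eq_comp_quotMap p I (LinearMap.range (wMap p I)).mkQ (fun x hx => by
      rw [Submodule.mkQ_apply, Submodule.Quotient.mk_eq_zero]
      refine ⟨FrobPullback.tmul p 1 (1 ⊗ₜ ⟨x, hx⟩), ?_⟩
      rw [wMap_tmul, one_pow, mul_one])
    have h := LinearMap.congr_fun hg t
    rw [LinearMap.comp_apply, ht, map_zero] at h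
    exact (Submodule.Quotient.mk_eq_zero _).1 h.symm
  · rintro ⟨y, rfl⟩
    exact LinearMap.congr_fun (quotMap_comp_wMap p I) y

end exactness

/-! ### A split injection forces `I ∩ 𝔪 ^ 2 ⊆ 𝔪 I`. -/

section residue

/-- The reduction map from `B₁` to the residue field, where `B = A / I` and `B₁ = B / pB`. -/
def redModResidue (p : ℕ) {A : Type*} [CommRing A] [IsLocalRing A]
    [CharP (ResidueField A) p] {I : Ideal A} (hI : I ≤ maximalIdeal A) : RedMod p (A ⧸ I) →+* ResidueField A :=
  Ideal.Quotient.lift (Ideal.span {(p : A ⧸ I)})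
    (Ideal.Quotient.lift I (residue A) fun _ hx => (residue_eq_zero_iff _).2 (hI hx)) (by
      intro b hb
      obtain ⟨c, rfl⟩ := Ideal.mem_span_singleton.1 hb
      rw [map_mul, map_natCast, CharP.cast_eq_zero, zero_mul])

theorem redModResidue_algebraMap (p : ℕ) {A : Type*} [CommRing A] [IsLocalRing A]
    [CharP (ResidueField A) p] {I : Ideal A} (hI : I ≤ maximalIdeal A) (a : A) :
    redModResidue p hI (algebraMap A (RedMod p (A ⧸ I)) a) = residue A a := rfl

theorem redModResidue_surjective (p : ℕ) {A : Type*} [CommRing A] [IsLocalRing A]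
    [CharP (ResidueField A) p] {I : Ideal A} (hI : I ≤ maximalIdeal A) :
    Function.Surjective (redModResidue p hI) := fun b => by
  obtain ⟨a, rfl⟩ := residue_surjective b
  exact ⟨_, redModResidue_algebraMap p hI a⟩

theorem isLocalRing_redMod (p : ℕ) {A : Type*} [CommRing A] [IsLocalRing A]
    [CharP (ResidueField A) p] {I : Ideal A} (hI : I ≤ maximalIdeal A) : IsLocalRing (RedMod p (A ⧸ I)) := by
  have : Nontrivial (RedMod p (A ⧸ I)) := (redModResidue p hI).domain_nontrivial
  refine .of_surjective' (algebraMap A (RedMod p (A ⧸ I))) ?_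
  exact Ideal.Quotient.mk_surjective.comp (Ideal.Quotient.mk_surjective (I := I))

/-- A Frobenius-Witt derivation with values in the residue field kills `𝔪 ^ 2`. -/
theorem IsFWDerivation.eq_zero_of_mem_sq {p : ℕ} (hp : p.Prime) {A : Type*} [CommRing A]
    [IsLocalRing A] {D : A → ResidueField A} (hD : IsFWDerivation p D) {x : A}
    (hx : x ∈ maximalIdeal A ^ 2) : D x = 0 := by
  have key : ∀ a ∈ maximalIdeal A, ∀ z : ResidueField A, a • z = 0 := fun a ha z => by
    rw [Algebra.smul_def, ResidueField.algebraMap_eq, (residue_eq_zero_iff _).2 ha, zero_mul]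
  -- Membership in `𝔪` is carried through the induction so that the `P`-term vanishes in the sum
  -- case.
  have h : x ∈ maximalIdeal A ∧ D x = 0 := by
    rw [pow_two] at hx
    induction hx using Submodule.mul_induction_on' with
    | mem_mul_mem a ha b hb =>
      refine ⟨Ideal.mul_mem_right _ _ ha, ?_⟩
      rw [hD.map_mul, key _ (Ideal.pow_mem_of_mem _ hb _ hp.pos),
        key _ (Ideal.pow_mem_of_mem _ ha _ hp.pos), add_zero]
    | add a _ b _ ha hb =>
      refine ⟨add_mem ha.1 hb.1, ?_⟩
      rw [hD.map_add, ha.2, hb.2, key _ (polyP_mem p _ ha.1 b), sub_zero, add_zero]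
  exact h.2

/-- Elements of a module over a local ring on which all linear forms with values in the residue
field vanish are multiples of the maximal ideal. -/
theorem mem_maximalIdeal_smul_top {A M : Type*} [CommRing A] [IsLocalRing A] [AddCommGroup M]
    [Module A M] (x : M) (h : ∀ f : M →ₗ[A] ResidueField A, f x = 0) :
    x ∈ maximalIdeal A • (⊤ : Submodule A M) := by
  let : Field (A ⧸ maximalIdeal A) := Ideal.Quotient.field _
  rw [← Submodule.Quotient.mk_eq_zero, ← Module.forall_dual_apply_eq_zero_iff (A ⧸ maximalIdeal A)]
  intro f
  exact h ((f.restrictScalars A).comp (Submodule.mkQ _))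

/-- If `w : F^*(I ⊗_A B₁) → FΩ¹_A ⊗_A B₁` is a split injection, then `B = A / I` satisfies `I ∩ 𝔪 ^ 2 ⊆ 𝔪 I`. -/
theorem inf_sq_le_mul_of_leftInverse (p : ℕ) [hp : Fact p.Prime] {A : Type*} [CommRing A]
    [IsLocalRing A] [CharP (ResidueField A) p] {I : Ideal A} (hI : I ≤ maximalIdeal A)
    (r : RedMod p (A ⧸ I) ⊗[A] FOmega p A →ₗ[RedMod p (A ⧸ I)]
      FrobPullback p (A ⧸ I) (RedMod p (A ⧸ I) ⊗[A] I))
    (hr : r ∘ₗ wMap p I = LinearMap.id) : I ⊓ maximalIdeal A ^ 2 ≤ maximalIdeal A * I := by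
  rintro x ⟨hxI, hx2⟩
  have hx : (⟨x, hxI⟩ : I) ∈ maximalIdeal A • (⊤ : Submodule A I) := by
    refine mem_maximalIdeal_smul_top _ fun f => ?_
    let : Algebra (RedMod p (A ⧸ I)) (ResidueField A) := (redModResidue p hI).toAlgebra
    have : IsScalarTower A (RedMod p (A ⧸ I)) (ResidueField A) := .of_algebraMap_eq fun _ => rfl
    let h := f.liftBaseChange (RedMod p (A ⧸ I))
    -- The `p`-th power makes the linear form Frobenius-semilinear, hence a form on `F^*(I ⊗_A B₁)`;
    -- nothing is lost, since `f x ^ p = 0` still gives `f x = 0`.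
    let h' : RedMod p (A ⧸ I) ⊗[A] I →ₛₗ[frob p (A ⧸ I)] ResidueField A :=
      { toFun := fun z => h z ^ p
        map_add' := fun y z => by rw [map_add, add_pow_char]
        map_smul' := fun b z => by
          rw [map_smul, Algebra.smul_def, mul_pow, ← map_pow, ← Algebra.smul_def]
          rfl }
    let Ψ := FrobPullback.lift p h' ∘ₗ r
    let D : A → ResidueField A := fun a => Ψ (1 ⊗ₜ univ p a)
    have hsmul : ∀ (a : A) (ω : FOmega p A), Ψ (1 ⊗ₜ (a • ω)) = a • Ψ (1 ⊗ₜ ω) := fun a ω => by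
      rw [TensorProduct.tmul_smul, ← algebraMap_smul (RedMod p (A ⧸ I)) a, map_smul,
        algebraMap_smul]
    have hD : IsFWDerivation p D := by
      constructor
      · intro a b
        simp only [D]
        rw [(univ_isFWDerivation p A).map_add, TensorProduct.tmul_sub, TensorProduct.tmul_add,
          map_sub, map_add, hsmul]
      · intro a b
        simp only [D]
        rw [(univ_isFWDerivation p A).map_mul, TensorProduct.tmul_add, map_add, hsmul, hsmul]
    have h1 : D x = f ⟨x, hxI⟩ ^ p := by
      have h2 := LinearMap.congr_fun hr (FrobPullback.tmul p 1 (1 ⊗ₜ ⟨x, hxI⟩))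
      rw [LinearMap.comp_apply, wMap_tmul, one_pow, mul_one] at h2
      change FrobPullback.lift p h' (r _) = _
      rw [h2, LinearMap.id_apply, FrobPullback.lift_tmul, one_smul]
      change h (1 ⊗ₜ ⟨x, hxI⟩) ^ p = _
      rw [LinearMap.liftBaseChange_tmul, one_smul]
    rw [hD.eq_zero_of_mem_sq hp.out hx2] at h1
    exact pow_eq_zero_iff hp.out.ne_zero |>.1 h1.symm
  have h1 := Submodule.mem_map_of_mem (f := I.subtype) hx
  rwa [Submodule.map_smul'', Submodule.map_top, Submodule.range_subtype] at h1

end residue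

/-! ### A regular quotient makes the sequence split. -/

section regular

variable (p : ℕ) [hp : Fact p.Prime] {A : Type*} [CommRing A] {I : Ideal A}

/-- As `A → A / pA` is onto, tensoring over `A` and over `A / pA` agree, so this is base change of a
finite free module along `A / pA → B₁`. -/
theorem free_finite_baseChange_fOmega [IsOverZLocalized p A]
    (hfree : Module.Free (RedMod p A) (FOmega p A))
    (hfin : Module.Finite (RedMod p A) (FOmega p A)) (I : Ideal A) :
    Module.Free (RedMod p (A ⧸ I)) (RedMod p (A ⧸ I) ⊗[A] FOmega p A) ∧
      Module.Finite (RedMod p (A ⧸ I)) (RedMod p (A ⧸ I) ⊗[A] FOmega p A) := by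
  let θ : RedMod p A →+* RedMod p (A ⧸ I) :=
    Ideal.Quotient.lift _ (algebraMap A (RedMod p (A ⧸ I))) (by
      intro a ha
      obtain ⟨b, rfl⟩ := Ideal.mem_span_singleton.1 ha
      have : (p : RedMod p (A ⧸ I)) = 0 := by
        rw [← map_natCast (Ideal.Quotient.mk _)]
        exact Ideal.Quotient.eq_zero_iff_mem.2 (Ideal.mem_span_singleton_self _)
      rw [map_mul, map_natCast, this, zero_mul])
  let : Algebra (RedMod p A) (RedMod p (A ⧸ I)) := θ.toAlgebra
  have : IsScalarTower A (RedMod p A) (RedMod p (A ⧸ I)) := .of_algebraMap_eq fun _ => rfl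
  have : TensorProduct.CompatibleSMul A (RedMod p A) (RedMod p (A ⧸ I)) (FOmega p A) :=
    ⟨fun r b ω => by
      obtain ⟨a, rfl⟩ := Ideal.Quotient.mk_surjective r
      exact TensorProduct.smul_tmul a b ω⟩
  let e : RedMod p (A ⧸ I) ⊗[RedMod p A] FOmega p A ≃ₗ[RedMod p (A ⧸ I)]
      RedMod p (A ⧸ I) ⊗[A] FOmega p A := TensorProduct.equivOfCompatibleSMul ..
  exact ⟨.of_equiv e, .equiv e⟩

variable [IsLocalRing A] [CharP (ResidueField A) p]

/-- Linear forms on `FΩ¹_A ⊗_A k` dual to `w x_i`, for a family of elements `x_i` which is linearly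
independent modulo `𝔪 ^ 2`. -/
theorem exists_isFWDerivation_dual {s : Set (maximalIdeal A)}
    (hs : LinearIndepOn (ResidueField A) (maximalIdeal A).toCotangent s) (i : s) :
    ∃ D : A → ResidueField A, IsFWDerivation p D ∧
      ∀ j : s, D (j : maximalIdeal A) = (Finsupp.single j 1 : s →₀ ResidueField A) i := by
  obtain ⟨f, hf⟩ := (Finsupp.linearCombination (ResidueField A)
    fun j : s => (maximalIdeal A).toCotangent j).exists_leftInverse_of_injective
      (LinearMap.ker_eq_bot.2 hs)
  have hfj : ∀ j : s, f ((maximalIdeal A).toCotangent j) = Finsupp.single j 1 := fun j => by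
    have := LinearMap.congr_fun hf (Finsupp.single j 1)
    simpa using this
  -- The `i`-th coordinate is raised to the power `p` for semilinearity; its values `0` and `1` on
  -- `s` are unaffected.
  let φ : maximalIdeal A →+ ResidueField A :=
    { toFun := fun y => f ((maximalIdeal A).toCotangent y) i ^ p
      map_zero' := by simp [hp.out.ne_zero]
      map_add' := fun y z => by rw [map_add, map_add, Finsupp.add_apply, add_pow_char] }
  obtain ⟨D, hD, hDφ⟩ := exists_isFWDerivation_eq (p := p) φ (fun a y => by
    change f ((maximalIdeal A).toCotangent (a • y)) i ^ p = _
    rw [map_smul, ← algebraMap_smul (ResidueField A) a, map_smul, Finsupp.smul_apply, smul_eq_mul,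
      mul_pow]
    rfl)
  refine ⟨D, hD, fun j => ?_⟩
  rw [hDφ]
  change f _ i ^ p = _
  rw [hfj]
  by_cases h : j = i
  · simp [h]
  · simp [h, hp.out.ne_zero]

/-- A family of elements of a finite free module over a local ring is part of a basis as soon as it
admits a dual family of linear forms with values in the residue field. -/
theorem exists_leftInverse_of_dual {R k L ι : Type*} [CommRing R] [IsLocalRing R] [Field k]
    [Algebra R k] [AddCommGroup L] [Module R L] [Module.Projective R L] [Finite ι]
    (hk : Function.Surjective (algebraMap R k)) (l : (ι → R) →ₗ[R] L) (g : L →ₗ[R] (ι → k))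
    (hg : ∀ v i, g (l v) i = algebraMap R k (v i)) :
    ∃ l' : L →ₗ[R] (ι → R), l' ∘ₗ l = LinearMap.id := by
  have := Fintype.ofFinite ι
  let Q : (ι → R) →ₗ[R] (ι → k) := (Algebra.linearMap R k).compLeft ι
  have hQ : Function.Surjective Q := fun v => by
    choose w hw using hk
    exact ⟨fun i => w (v i), funext fun i => hw (v i)⟩
  -- The lift `ρ` makes `ρ ∘ l` the identity modulo the maximal ideal: surjective by Nakayama, hence
  -- bijective as an endomorphism of a finite module.
  obtain ⟨ρ, hρ⟩ := Module.projective_lifting_property Q g hQ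
  have hE : ∀ v i, v i - ρ (l v) i ∈ maximalIdeal R := fun v i => by
    have h1 : algebraMap R k (ρ (l v) i) = algebraMap R k (v i) :=
      (congrFun (LinearMap.congr_fun hρ (l v)) i).trans (hg v i)
    have h2 : algebraMap R k (v i - ρ (l v) i) = 0 := by rw [map_sub, h1, sub_self]
    exact fun hu => (hu.map (algebraMap R k)).ne_zero h2
  have hsurj : Function.Surjective (ρ ∘ₗ l) := by
    rw [← LinearMap.range_eq_top, ← top_le_iff]
    refine Submodule.le_of_le_smul_of_le_jacobson_bot (I := maximalIdeal R) Module.Finite.fg_top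
      (IsLocalRing.maximalIdeal_le_jacobson ⊥) fun v _ => ?_
    classical
    have h1 : v - ρ (l v) = ∑ i, (v i - ρ (l v) i) • (Pi.single i 1 : ι → R) := by
      simpa using pi_eq_sum_univ' (v - ρ (l v))
    rw [← add_sub_cancel (ρ (l v)) v]
    refine Submodule.add_mem_sup ⟨v, rfl⟩ ?_
    rw [h1]
    exact Submodule.sum_mem _ fun i _ => Submodule.smul_mem_smul (hE v i) Submodule.mem_top
  let e := LinearEquiv.ofBijective (ρ ∘ₗ l)
    (OrzechProperty.bijective_of_surjective_endomorphism _ hsurj)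
  exact ⟨e.symm.toLinearMap ∘ₗ ρ, LinearMap.ext fun v => e.symm_apply_apply v⟩

/-- The generators `s` give a surjection `π : B₁ ^ s → F^*(I ⊗_A B₁)`. Dual FW-derivations provide a
left inverse `l'` of `wMap ∘ π`; since `π` is onto, `π ∘ l'` is a left inverse of `wMap`. -/
theorem exists_leftInverse_wMap [IsNoetherianRing A] (hI : I ≤ maximalIdeal A)
    {s : Set (maximalIdeal A)}
    (hs : LinearIndepOn (ResidueField A) (maximalIdeal A).toCotangent s)
    (hIs : I = Ideal.span (Subtype.val '' s))
    (hproj : Module.Projective (RedMod p (A ⧸ I)) (RedMod p (A ⧸ I) ⊗[A] FOmega p A)) :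
    ∃ r, r ∘ₗ wMap p I = LinearMap.id := by
  have := (finite_of_linearIndepOn_toCotangent hs).fintype
  let x : s → I := fun i =>
    ⟨(i : maximalIdeal A), hIs ▸ Ideal.subset_span ⟨i, i.2, rfl⟩⟩
  have hx : Submodule.span A (Set.range x) = ⊤ := by
    refine Submodule.map_injective_of_injective (f := I.subtype) Subtype.val_injective ?_
    rw [Submodule.map_span, Submodule.map_top, Submodule.range_subtype, ← Set.range_comp]
    conv_rhs => rw [hIs]
    congr 1
    ext y
    simp [x]
  have hspan := span_frobPullback_eq_top p I hx
  let π := Fintype.linearCombination (RedMod p (A ⧸ I)) fun i =>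
    (FrobPullback.tmul p 1 (1 ⊗ₜ[A] x i) : FrobPullback p (A ⧸ I) (RedMod p (A ⧸ I) ⊗[A] I))
  have hπ : Function.Surjective π := by
    rw [← LinearMap.range_eq_top, Fintype.range_linearCombination, hspan]
  have := isLocalRing_redMod p hI
  let : Algebra (RedMod p (A ⧸ I)) (ResidueField A) := (redModResidue p hI).toAlgebra
  have : IsScalarTower A (RedMod p (A ⧸ I)) (ResidueField A) := .of_algebraMap_eq fun _ => rfl
  choose D hD hDx using exists_isFWDerivation_dual p hs
  let g : RedMod p (A ⧸ I) ⊗[A] FOmega p A →ₗ[RedMod p (A ⧸ I)] (s → ResidueField A) :=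
    LinearMap.pi fun i => (FOmega.lift (hD i)).liftBaseChange (RedMod p (A ⧸ I))
  obtain ⟨l', hl'⟩ := exists_leftInverse_of_dual (redModResidue_surjective p hI)
    (wMap p I ∘ₗ π) g (fun v i => by
      rw [LinearMap.comp_apply, Fintype.linearCombination_apply, map_sum, map_sum,
        Finset.sum_apply, Finset.sum_eq_single i]
      · rw [map_smul, wMap_tmul, map_smul, Pi.smul_apply, LinearMap.pi_apply,
          LinearMap.liftBaseChange_tmul, FOmega.lift_univ, hDx, Finsupp.single_eq_same,
          Algebra.smul_def]
        simp
      · intro j _ hji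
        rw [map_smul, wMap_tmul, map_smul, Pi.smul_apply, LinearMap.pi_apply,
          LinearMap.liftBaseChange_tmul, FOmega.lift_univ, hDx, Finsupp.single_eq_of_ne hji.symm,
          smul_zero, smul_zero]
      · exact fun h => absurd (Finset.mem_univ i) h)
  refine ⟨π ∘ₗ l', LinearMap.ext fun z => ?_⟩
  obtain ⟨v, rfl⟩ := hπ z
  exact congrArg π (LinearMap.congr_fun hl' v)

end regular

end FrobeniusWitt

end

theorem mainTheorem5 {A : Type*} [CommRing A] [IsRegularLocalRing A] (p : ℕ) [Fact p.Prime]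
    [CharP (IsLocalRing.ResidueField A) p] (I : Ideal A) (_hI : I ≤ IsLocalRing.maximalIdeal A) :
    (FrobeniusWitt.IsSplitExact (FrobeniusWitt.wMap p I) (FrobeniusWitt.quotMap p I) →
      IsRegularLocalRing (A ⧸ I)) ∧
    (Module.Free (FrobeniusWitt.RedMod p A) (FrobeniusWitt.FOmega p A) →
      Module.Finite (FrobeniusWitt.RedMod p A) (FrobeniusWitt.FOmega p A) →
      IsRegularLocalRing (A ⧸ I) →
      FrobeniusWitt.IsSplitExact (FrobeniusWitt.wMap p I) (FrobeniusWitt.quotMap p I) ∧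
      Module.Free (FrobeniusWitt.RedMod p (A ⧸ I)) (FrobeniusWitt.FOmega p (A ⧸ I)) ∧
      Module.Finite (FrobeniusWitt.RedMod p (A ⧸ I)) (FrobeniusWitt.FOmega p (A ⧸ I))) := by
  have hexact := FrobeniusWitt.exact_wMap_quotMap p I
  have hsurj := FrobeniusWitt.quotMap_surjective p I
  constructor
  · rintro ⟨hinj, -, -, hsplit⟩
    obtain ⟨r, hr⟩ := ((hexact.split_tfae hinj hsurj).out 0 1).1 hsplit
    exact FrobeniusWitt.isRegularLocalRing_quotient_of_inf_le_mul _hI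
      (FrobeniusWitt.inf_sq_le_mul_of_leftInverse p _hI r hr)
  · intro hfree hfin hreg
    obtain ⟨hfree', hfin'⟩ := FrobeniusWitt.free_finite_baseChange_fOmega p hfree hfin I
    obtain ⟨s, hs, hIs⟩ := FrobeniusWitt.exists_span_eq_of_isRegularLocalRing_quotient _hI hreg
    obtain ⟨r, hr⟩ := FrobeniusWitt.exists_leftInverse_wMap p _hI hs hIs inferInstance
    have hinj : Function.Injective (FrobeniusWitt.wMap p I) :=
      Function.LeftInverse.injective (LinearMap.congr_fun hr)
    have htfae := (hexact.split_tfae hinj hsurj).out 0 1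
    obtain ⟨t, ht⟩ := htfae.2 ⟨r, hr⟩
    have := FrobeniusWitt.isLocalRing_redMod p _hI
    have hfinB : Module.Finite (FrobeniusWitt.RedMod p (A ⧸ I)) (FrobeniusWitt.FOmega p (A ⧸ I)) :=
      Module.Finite.of_surjective _ hsurj
    -- A direct summand of a projective module is projective, and a finite projective module over
    -- the local ring `B₁` is free.
    have := Module.Projective.of_split t _ ht
    exact ⟨⟨hinj, hexact, hsurj, t, ht⟩, Module.free_of_flat_of_isLocalRing, hfinB⟩
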